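/- **Conventions.** For a domain $A$ with fraction field $K(A)$, an ideal $I\subset A$ is *central* if for all $a\in A$ and all sums of squares $b\in\sum K(A)^2$, $a^2+b\in I$ implies $a\in I$; $\mathrm{Rad}^C(A)$ denotes the intersection of the ideals of $A$ that are both maximal and central; $A$ is *real* if $-1\notin\sum K(A)^2$. For an extension $A\subset B$ of domains let $\widetilde A'_B$ be the ring of all $b\in B\cap K(A)$ (intersection in $K(B)$) that are integral over $A$, and put $$A^{s_c,*}_B=\{b\in\widetilde A'_B \mid b_{\mathfrak p}\in A_{\mathfrak p}+\mathrm{Rad}^C((\widetilde A'_B)_{\mathfrak p})\ \text{for every central prime ideal } \mathfrak p \text{ of } A\}$$ if $A$ is real, and let $A^{s_c,*}_B$ be the integral closure of $A$ in $B$ if $A$ is not real. A point $x$ of an integral scheme is *central* if it has an affine open neighbourhood $\operatorname{Spec}A$ in which it corresponds to a central prime ideal of $A$. A dominant morphism of integral schemes $Z\to X$ is *centrally subintegral* if it is finite, it induces a bijection from the central points of $Z$ onto the central points of $X$, and for every central point $z\in Z$ with image $x$ the residue field extension $k(x)\to k(z)$ is an isomorphism. **Theorem.** Let $X$ and $Y$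 be integral schemes of finite type over $\mathbb R$ and $\pi:Y\to X$ a dominant morphism of finite type. There is an integral scheme $X^{s_c,*}_Y$ with a factorization $Y\xrightarrow{\,j\,}X^{s_c,*}_Y\xrightarrow{\,\nu\,}X$ of $\pi$, where $\nu$ is finite and, for every affine open $U\subset X$, pullback along $j$ identifies $\Gamma(\nu^{-1}(U),\mathcal O)$ with the subring $\Gamma(U,\mathcal O_X)^{s_c,*}_{\Gamma(\pi^{-1}(U),\mathcal O_Y)}$ of $\Gamma(\pi^{-1}(U),\mathcal O_Y)$. Moreover, for every such $(X^{s_c,*}_Y,j,\nu)$ and every factorization $Y\xrightarrow{\,q\,}Z\xrightarrow{\,p\,}X$ of $\pi$ with $Z$ an integral scheme, $p$ separated and $q$ dominant, the morphism $p$ is centrally subintegral if and only if $\nu$ factors through $p$ compatibly with $Y$, i.e. if and only if there is a morphism $h:X^{s_c,*}_Y\to Z$ with $p\circ h=\nu$ and $h\circ j=q$. -/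

import Mathlib

open CategoryTheory AlgebraicGeometry

namespace CentralGeometry

section Rings

/-- An ideal `I` of a domain `A` is central if, for all `a ∈ A` and all sums of squares `b` of
elements of the fraction field of `A`, `a ^ 2 + b ∈ I` implies `a ∈ I`. -/
def IsCentralIdeal {A : Type*} [CommRing A] (I : Ideal A) : Prop :=
  ∀ (a : A) (b : FractionRing A), IsSumSq b →
    ∀ c ∈ I, algebraMap A (FractionRing A) c = algebraMap A (FractionRing A) a ^ 2 + b → a ∈ I

/-- A domain is real if `-1` is not a sum of squares in its fraction field. -/
def IsRealDomain (A : Type*) [CommRing A] : Prop :=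
  ¬ IsSumSq (-1 : FractionRing A)

/-- The central Jacobson radical: the intersection of all ideals which are maximal and central
(the unit ideal if there are none). -/
def centralJacobson (A : Type*) [CommRing A] : Ideal A :=
  sInf {I : Ideal A | I.IsMaximal ∧ IsCentralIdeal I}

variable (A B : Type*) [CommRing A] [CommRing B] [Algebra A B]

/-- The birational closure of `A` in `B`: the elements of `B` which, in the fraction field of `B`,
belong to the fraction field of `A` (`b = a / s` is written `s * b = a`). -/
def birationalClosure : Subalgebra A B where
  carrier := {b | ∃ a s : A, s ∈ nonZeroDivisors A ∧ algebraMap A B s * b = algebraMap A B a}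
  mul_mem' := by
    rintro x y ⟨a, s, hs, hx⟩ ⟨a', s', hs', hy⟩
    refine ⟨a * a', s * s', mul_mem hs hs', ?_⟩
    rw [map_mul, map_mul, ← hx, ← hy]; ring
  add_mem' := by
    rintro x y ⟨a, s, hs, hx⟩ ⟨a', s', hs', hy⟩
    refine ⟨s' * a + s * a', s * s', mul_mem hs hs', ?_⟩
    rw [map_mul, map_add, map_mul, map_mul, ← hx, ← hy]; ring
  algebraMap_mem' a := ⟨a, 1, one_mem _, by simp⟩

/-- The integral and birational closure of `A` in `B`. -/
def integralBirationalClosure : Subalgebra A B :=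
  integralClosure A B ⊓ birationalClosure A B

/-- The central gluing of `B` over `A`: the `b ∈ B` such that, for every central prime ideal `p`
of `A`, the image of `b` in `B_p` belongs to `A_p + Rad^C(B_p)`. -/
def centralGluing : Subalgebra A B where
  carrier := {b | ∀ (p : Ideal A) [p.IsPrime], IsCentralIdeal p →
    ∃ u : Localization p.primeCompl,
      algebraMap B (Localization (Algebra.algebraMapSubmonoid B p.primeCompl)) b -
        algebraMap (Localization p.primeCompl)
          (Localization (Algebra.algebraMapSubmonoid B p.primeCompl)) u ∈
      centralJacobson (Localization (Algebra.algebraMapSubmonoid B p.primeCompl))}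
  mul_mem' := by
    intro x y hx hy p _ hp
    obtain ⟨u, hu⟩ := hx p hp
    obtain ⟨v, hv⟩ := hy p hp
    refine ⟨u * v, ?_⟩
    have h := add_mem
      (Ideal.mul_mem_left _ (algebraMap B (Localization
        (Algebra.algebraMapSubmonoid B p.primeCompl)) x) hv)
      (Ideal.mul_mem_left _ (algebraMap (Localization p.primeCompl) (Localization
        (Algebra.algebraMapSubmonoid B p.primeCompl)) v) hu)
    convert h using 1
    rw [map_mul, map_mul]; ring
  add_mem' := by
    intro x y hx hy p _ hp
    obtain ⟨u, hu⟩ := hx p hp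
    obtain ⟨v, hv⟩ := hy p hp
    refine ⟨u + v, ?_⟩
    convert add_mem hu hv using 1
    rw [map_add, map_add]; ring
  algebraMap_mem' a p _ _ := by
    refine ⟨algebraMap A _ a, ?_⟩
    rw [← IsScalarTower.algebraMap_apply A B, ← IsScalarTower.algebraMap_apply A
      (Localization p.primeCompl), sub_self]
    exact zero_mem _

open Classical in
/-- The central seminormalization of `A` in `B`: if `A` is a real domain, the central gluing over
`A` of the integral and birational closure of `A` in `B`; otherwise, the integral closure of `A`
in `B`. -/
noncomputable def centralSeminormalization : Subalgebra A B :=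
  if IsRealDomain A then
    (centralGluing A (integralBirationalClosure A B)).map (integralBirationalClosure A B).val
  else integralClosure A B

end Rings

section Schemes

/-- A point `x` of an integral scheme is central if it has an affine open neighbourhood
`U = Spec A` such that the prime ideal of `A` corresponding to `x` is central. -/
def IsCentralPoint {X : Scheme} (x : X) : Prop :=
  ∃ (U : X.Opens) (hU : IsAffineOpen U) (hx : x ∈ U),
    IsCentralIdeal (hU.primeIdealOf ⟨x, hx⟩).asIdeal

/-- A (dominant) morphism of integral schemes is centrally subintegral if it is finite and induces
a bijective and equiresidual map on central points. -/
structure IsCentrallySubintegral {Z X : Scheme} (p : Z ⟶ X) : Prop where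
  isFinite : IsFinite p
  bijOn : Set.BijOn p {z | IsCentralPoint z} {x | IsCentralPoint x}
  equiresidual : ∀ z : Z, IsCentralPoint z → Function.Bijective (p.residueFieldMap z).hom

/-- The sections over an affine open `U` of the central seminormalization of the structure sheaf
of `X` in the direct image of the structure sheaf of `Y`, as a subring of `Γ(Y, π⁻¹(U))`. -/
noncomputable def seminormalizationSections {Y X : Scheme} (π : Y ⟶ X) (U : X.Opens) :
    Subring Γ(Y, π ⁻¹ᵁ U) :=
  letI : Algebra Γ(X, U) Γ(Y, π ⁻¹ᵁ U) := (π.app U).hom.toAlgebra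
  (centralSeminormalization Γ(X, U) Γ(Y, π ⁻¹ᵁ U)).toSubring

/-- `Y ⟶ S ⟶ X` exhibits `S` as the relative spectrum over `X` of the central seminormalization of
the structure sheaf of `X` in the direct image of the structure sheaf of `Y`: the morphism
`ν : S ⟶ X` is affine and, over every affine open `U` of `X`, pulling back along `j` identifies
`Γ(S, ν⁻¹(U))` with the central seminormalization of `Γ(X, U)` in `Γ(Y, π⁻¹(U))`. -/
structure IsCentralSeminormalization {Y S X : Scheme} (π : Y ⟶ X) (j : Y ⟶ S) (ν : S ⟶ X) :
    Prop where
  fac : j ≫ ν = π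
  isAffineHom : IsAffineHom ν
  injective : ∀ U : X.Opens, IsAffineOpen U →
    Function.Injective (j.appLE (ν ⁻¹ᵁ U) (π ⁻¹ᵁ U) (by rw [← fac]; exact le_rfl)).hom
  range_eq : ∀ U : X.Opens, IsAffineOpen U →
    (j.appLE (ν ⁻¹ᵁ U) (π ⁻¹ᵁ U) (by rw [← fac]; exact le_rfl)).hom.range =
      seminormalizationSections π U

end Schemes

end CentralGeometry

/-! The heart is a fact about rings: if A ⊂ C is integral and birational, every central prime p of A
lies under a central prime of C (`IsCentralIdeal.exists_isPrime_comap_eq`). Its core is that s² + b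
∈ pC, with b a sum of squares, forces s ∈ p (`IsCentralIdeal.mem_of_sq_add_mem_map`). The element x
= s² + b is a root of a monic polynomial whose lower coefficients lie in p. Multiplying its equation
by D^n, where D = s²/x, writes s^(2n) as a combination of elements of p with bounded coefficients,
because 1 - D² is a sum of squares. Centrality of p then absorbs this combination.

By `mem_centralGluing_iff`, an element is in the gluing when, over each central p, it takes one
common value in k(p) at all the central primes above p. With lying over, this shows that over a real
domain A an integral subextension of B lies in the central seminormalization exactly when it is
bijective and equiresidual on central primes. One direction is
`algebraMap_mem_centralSeminormalization`; the other is `exists_isCentralIdeal_comap_eq`,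
`exists_forall_sub_mem_of_isCentralIdeal` and `le_of_comap_eq_of_isCentralIdeal`. A domain that is
not real has no proper central ideal, so there only integrality matters.

The construction commutes with inverting one element, so the subrings glue to a scheme affine over X
(`exists_isAffineHom_of_subrings`). It is finite over X because integral closures are finite here
(`finite_integralClosure_of_finiteType`). If p : Z → X is centrally subintegral, the sections of Z
lie in the seminormalization, and these inclusions glue to S → Z. Conversely, a morphism S → Z makes
p finite, by descent from ν (`isFinite_of_isFinite_comp`), and places the sections of Z inside the
seminormalization, where the ring statement applies. -/

namespace CentralGeometry

/-! ### Central ideals, localization, and lying over for central primes. -/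

section CentralIdeals

lemma IsSumSq.map_ringHom {K L : Type*} [CommRing K] [CommRing L] (f : K →+* L) {b : K}
    (h : IsSumSq b) : IsSumSq (f b) := by
  induction h with
  | zero => simp
  | sq_add a _ ih => rw [map_add, map_mul]; exact IsSumSq.add (.mul_self _) ih

lemma isSumSq_sq_mul {K : Type*} [CommRing K] (x : K) {b : K} (h : IsSumSq b) :
    IsSumSq (x ^ 2 * b) := by
  rw [sq]; exact (IsSumSq.mul_self x).mul h

lemma isCentralIdeal_iff {A : Type*} [CommRing A] (K : Type*) [Field K] [Algebra A K]
    [IsFractionRing A K] (I : Ideal A) :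
    IsCentralIdeal I ↔ ∀ (a : A) (b : K), IsSumSq b → ∀ c ∈ I,
      algebraMap A K c = algebraMap A K a ^ 2 + b → a ∈ I := by
  let e := FractionRing.algEquiv A K
  constructor
  · intro h a b hb c hc hcb
    refine h a (e.symm b) (IsSumSq.map_ringHom (e.symm : K →+* FractionRing A) hb) c hc ?_
    apply e.injective
    simpa using hcb
  · intro h a b hb c hc hcb
    refine h a (e b) (IsSumSq.map_ringHom (e : FractionRing A →+* K) hb) c hc ?_
    simpa using congr(e $hcb)

lemma isRealDomain_iff {A : Type*} [CommRing A] (K : Type*) [Field K] [Algebra A K]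
    [IsFractionRing A K] : IsRealDomain A ↔ ¬ IsSumSq (-1 : K) := by
  let e := FractionRing.algEquiv A K
  refine not_congr ⟨fun h ↦ ?_, fun h ↦ ?_⟩
  · simpa using IsSumSq.map_ringHom (e : FractionRing A →+* K) h
  · simpa using IsSumSq.map_ringHom (e.symm : K →+* FractionRing A) h

/-- A domain which is not real has no proper central ideal. -/
lemma IsCentralIdeal.isRealDomain {A : Type*} [CommRing A] {I : Ideal A} (hI : IsCentralIdeal I)
    (h : I ≠ ⊤) : IsRealDomain A := by
  intro hA
  refine h ((Ideal.eq_top_iff_one _).mpr (hI 1 (-1) hA 0 I.zero_mem ?_))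
  simp

lemma IsRealDomain.isCentralIdeal_bot {A : Type*} [CommRing A] [IsDomain A]
    (h : IsRealDomain A) : IsCentralIdeal (⊥ : Ideal A) := by
  intro a b hb c hc hcb
  rw [Ideal.mem_bot] at hc ⊢
  subst hc
  by_contra ha
  have ha' : algebraMap A (FractionRing A) a ≠ 0 := by simpa using ha
  refine h ?_
  have : (-1 : FractionRing A) = (algebraMap A (FractionRing A) a)⁻¹ ^ 2 * b := by
    rw [map_zero] at hcb
    field_simp
    linear_combination hcb
  rw [this]
  exact isSumSq_sq_mul _ hb

lemma IsCentralIdeal.comap {A C : Type*} [CommRing A] [IsDomain A] [CommRing C] [IsDomain C]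
    {f : A →+* C} (hf : Function.Injective f) {P : Ideal C} (hP : IsCentralIdeal P) :
    IsCentralIdeal (P.comap f) := by
  intro a b hb c hc hcb
  let F : FractionRing A →+* FractionRing C := IsFractionRing.map hf
  have hF (x : A) : F (algebraMap A _ x) = algebraMap C _ (f x) := by
    simp [F, IsFractionRing.map]
  refine hP (f a) (F b) (IsSumSq.map_ringHom F hb) (f c) hc ?_
  rw [← hF, ← hF, hcb]; simp

/-- Birational rings thus share one fraction field, so centrality in either ring refers to the same
sums of squares. -/
lemma isFractionRing_of_birationalClosure_eq_top (A C K : Type*) [CommRing A] [IsDomain A]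
    [CommRing C] [IsDomain C] [Field K] [Algebra A C] [FaithfulSMul A C] [Algebra C K] [Algebra A K]
    [IsScalarTower A C K] [IsFractionRing C K] (h : birationalClosure A C = ⊤) :
    IsFractionRing A K where
  map_units s := by
    rw [isUnit_iff_ne_zero, IsScalarTower.algebraMap_apply A C K]
    simp
  surj z := by
    obtain ⟨c, d, hd, rfl⟩ := IsFractionRing.div_surjective (A := C) z
    obtain ⟨a, s, hs, hc⟩ : c ∈ birationalClosure A C := h ▸ Algebra.mem_top
    obtain ⟨a', s', hs', hd'⟩ : d ∈ birationalClosure A C := h ▸ Algebra.mem_top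
    have hi := FaithfulSMul.algebraMap_injective A C
    have hd0 : d ≠ 0 := nonZeroDivisors.ne_zero hd
    have ha' : a' ≠ 0 := by
      rintro rfl
      have : algebraMap A C s' ≠ 0 := by
        rw [Ne, map_eq_zero_iff _ hi]; exact nonZeroDivisors.ne_zero hs'
      simp_all
    refine ⟨(a * s', ⟨s * a', mul_mem hs (mem_nonZeroDivisors_of_ne_zero ha')⟩), ?_⟩
    have hdK : algebraMap C K d ≠ 0 := by simpa using hd0
    simp only [IsScalarTower.algebraMap_apply A C K, map_mul]
    rw [← hc, ← hd', map_mul, map_mul]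
    field_simp
  exists_of_eq {x y} hxy := by
    refine ⟨1, ?_⟩
    rw [IsScalarTower.algebraMap_apply A C K, IsScalarTower.algebraMap_apply A C K] at hxy
    rw [FaithfulSMul.algebraMap_injective A C (IsFractionRing.injective C K hxy)]

lemma birationalClosure_eq_top_of_isLocalization {A A' : Type*} [CommRing A]
    [CommRing A'] [Algebra A A'] (M : Submonoid A) (hM : M ≤ nonZeroDivisors A)
    [IsLocalization M A'] : birationalClosure A A' = ⊤ := by
  refine Algebra.eq_top_iff.mpr fun x ↦ ?_
  obtain ⟨⟨a, s⟩, h⟩ := IsLocalization.surj M x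
  exact ⟨a, s, hM s.2, by rw [mul_comm]; exact h⟩

lemma isCentralIdeal_comap_iff_of_isLocalization {A A' : Type*} [CommRing A] [IsDomain A]
    [CommRing A'] [IsDomain A'] [Algebra A A'] (M : Submonoid A) (hM : M ≤ nonZeroDivisors A)
    [IsLocalization M A'] (P : Ideal A') :
    IsCentralIdeal (P.comap (algebraMap A A')) ↔ IsCentralIdeal P := by
  have hi : Function.Injective (algebraMap A A') := IsLocalization.injective A' hM
  have : FaithfulSMul A A' := (faithfulSMul_iff_algebraMap_injective A A').mpr hi
  refine ⟨fun h ↦ ?_, fun h ↦ h.comap hi⟩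
  have := isFractionRing_of_birationalClosure_eq_top A A' (FractionRing A')
    (birationalClosure_eq_top_of_isLocalization M hM)
  rw [isCentralIdeal_iff (FractionRing A')] at h ⊢
  intro a b hb c hc hcb
  obtain ⟨⟨a₁, s⟩, ha₁⟩ := IsLocalization.surj M a
  obtain ⟨⟨c₁, t⟩, hc₁⟩ := IsLocalization.surj M c
  have hs := IsLocalization.map_units A' (s * t)
  -- With a = a₁/s and c = c₁/t, the relation c = a² + b is multiplied by (st)².
  have hmem := h (a₁ * t) (algebraMap A (FractionRing A') (s * t) ^ 2 * b) (isSumSq_sq_mul _ hb)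
    (c₁ * s ^ 2 * t) (by
      rw [Ideal.mem_comap, map_mul, map_mul, ← hc₁]
      exact Ideal.mul_mem_right _ _ (Ideal.mul_mem_right _ _ (Ideal.mul_mem_right _ _ hc))) (by
      simp only [IsScalarTower.algebraMap_apply A A' (FractionRing A'), map_mul, ← ha₁, ← hc₁,
        map_pow, hcb]
      ring)
  have : algebraMap A A' (a₁ * t) = algebraMap A A' (s * t : A) * a := by
    rw [map_mul, ← ha₁, map_mul]; ring
  rw [Ideal.mem_comap, this] at hmem
  exact (Ideal.unit_mul_mem_iff_mem P hs).mp hmem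

lemma isSumSq_one_sub_pow {K : Type*} [CommRing K] {D : K} (h : IsSumSq (1 - D ^ 2)) (k : ℕ) :
    IsSumSq (1 - (D ^ k) ^ 2) := by
  induction k with
  | zero => simp
  | succ k ih =>
    have : 1 - (D ^ (k + 1)) ^ 2 = (1 - D ^ 2) + D ^ 2 * (1 - (D ^ k) ^ 2) := by ring
    rw [this]
    exact h.add (isSumSq_sq_mul _ ih)

/-- A combination of elements of p with coefficients bounded by 1 has its square bounded by an
element of p. The induction uses (u + v)² = 2u² + 2v² - (u - v)². -/
lemma exists_mem_isSumSq_sub_sum_sq {A K ι : Type*} [CommRing A] [CommRing K] [Algebra A K]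
    (p : Ideal A) (S : Finset ι) (m : ι → A) (d : ι → K) (hm : ∀ i ∈ S, m i ∈ p)
    (hd : ∀ i ∈ S, IsSumSq (1 - d i ^ 2)) :
    ∃ e ∈ p, IsSumSq (algebraMap A K e - (∑ i ∈ S, algebraMap A K (m i) * d i) ^ 2) := by
  classical
  induction S using Finset.induction_on with
  | empty => exact ⟨0, p.zero_mem, by simp⟩
  | insert i S hi ih =>
    obtain ⟨e, he, h⟩ := ih (fun j hj ↦ hm j (Finset.mem_insert_of_mem hj))
      (fun j hj ↦ hd j (Finset.mem_insert_of_mem hj))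
    refine ⟨2 * m i ^ 2 + 2 * e, add_mem (p.mul_mem_left _ (p.pow_mem_of_mem
      (hm i (Finset.mem_insert_self _ _)) 2 two_pos)) (p.mul_mem_left _ he), ?_⟩
    rw [Finset.sum_insert hi]
    set y := ∑ i ∈ S, algebraMap A K (m i) * d i
    set x := algebraMap A K (m i)
    have h₁ := isSumSq_sq_mul x (hd i (Finset.mem_insert_self _ _))
    have h₂ := IsSumSq.mul_self (x * d i - y)
    refine (congrArg IsSumSq ?_).mp (((h₁.add h₁).add (h.add h)).add h₂)
    simp only [x, map_add, map_mul, map_pow, map_ofNat]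
    ring

/-- If an element `s ^ 2 + b` with `b` a sum of squares lies in the extension of a central prime
ideal `p`, then `s ∈ p`. -/
lemma IsCentralIdeal.mem_of_sq_add_mem_map {A C K : Type*} [CommRing A] [CommRing C] [Field K]
    [Algebra A C] [Algebra C K] [Algebra A K] [IsScalarTower A C K] [IsFractionRing A K]
    [Algebra.IsIntegral A C] (p : Ideal A) [p.IsPrime] (hp : IsCentralIdeal p) {s : A} {b : K}
    (hb : IsSumSq b) {c : C} (hc : c ∈ p.map (algebraMap A C))
    (h : algebraMap C K c = algebraMap A K s ^ 2 + b) : s ∈ p := by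
  obtain ⟨f, hf, hfc, hfp⟩ := Polynomial.exists_monic_aeval_eq_zero_forall_mem_of_mem_map hc
  rw [isCentralIdeal_iff K] at hp
  set x := algebraMap C K c
  set n := f.natDegree
  by_cases hx : x = 0
  · exact hp s b hb 0 p.zero_mem (by rw [map_zero, ← h, hx])
  set σ := algebraMap A K s
  -- Since x = σ² + b, the numerator x² - σ⁴ of 1 - D² is 2σ²b + b², a sum of squares.
  set D := σ ^ 2 / x
  have hDx : D * x = σ ^ 2 := div_mul_cancel₀ _ hx
  have hD : IsSumSq (1 - D ^ 2) := by
    have : 1 - D ^ 2 = x⁻¹ ^ 2 * (σ ^ 2 * b + σ ^ 2 * b + b * b) := by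
      simp only [D]
      field_simp
      rw [h]; ring
    rw [this]
    exact isSumSq_sq_mul _ (((isSumSq_sq_mul _ hb).add (isSumSq_sq_mul _ hb)).add (.mul_self b))
  have hfx : x ^ n + ∑ i ∈ Finset.range n, algebraMap A K (f.coeff i) * x ^ i = 0 := by
    have := congr(algebraMap C K $hfc)
    rw [← Polynomial.aeval_algebraMap_apply, Polynomial.aeval_eq_sum_range,
      Finset.sum_range_succ, map_zero] at this
    simp only [Algebra.smul_def] at this
    rw [show f.coeff f.natDegree = 1 from hf, map_one, one_mul, add_comm] at this
    exact this
  -- The integral equation of x multiplied by D^n: every D^i x^i becomes σ^(2i), and a factor D^(n -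
  -- i) with n - i > 0 remains.
  have key : (σ ^ 2) ^ n =
      -∑ i ∈ Finset.range n, algebraMap A K (f.coeff i * (s ^ 2) ^ i) * D ^ (n - i) := by
    have : (σ ^ 2) ^ n = D ^ n * x ^ n := by rw [← mul_pow, hDx]
    rw [this, eq_neg_of_add_eq_zero_left hfx, mul_neg, Finset.mul_sum]
    congr 1
    refine Finset.sum_congr rfl fun i hi ↦ ?_
    have : D ^ n = D ^ (n - i) * D ^ i := by
      rw [← pow_add, Nat.sub_add_cancel (Finset.mem_range.mp hi).le]
    have h' : D ^ i * x ^ i = (σ ^ 2) ^ i := by rw [← mul_pow, hDx]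
    rw [this, map_mul, map_pow, map_pow, ← h']
    ring
  obtain ⟨e, he, hsq⟩ := exists_mem_isSumSq_sub_sum_sq (K := K) p (Finset.range n)
    (fun i ↦ f.coeff i * (s ^ 2) ^ i) (fun i ↦ D ^ (n - i))
    (fun i hi ↦ p.mul_mem_right _ (hfp i (Finset.mem_range.mp hi).ne))
    (fun i _ ↦ isSumSq_one_sub_pow hD _)
  have : (s ^ 2) ^ n ∈ p := by
    refine hp _ _ hsq e he ?_
    rw [map_pow, map_pow, key]
    ring
  exact Ideal.IsPrime.mem_of_pow_mem ‹_› _ (Ideal.IsPrime.mem_of_pow_mem ‹_› _ this)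

/-- Lying over for central prime ideals along integral birational extensions. -/
theorem IsCentralIdeal.exists_isPrime_comap_eq {A C : Type*} [CommRing A] [IsDomain A] [CommRing C]
    [IsDomain C] [Algebra A C] [FaithfulSMul A C] [Algebra.IsIntegral A C]
    (h : birationalClosure A C = ⊤) (p : Ideal A) [p.IsPrime] (hp : IsCentralIdeal p) :
    ∃ P : Ideal C, P.IsPrime ∧ IsCentralIdeal P ∧ P.comap (algebraMap A C) = p := by
  let K := FractionRing C
  have := isFractionRing_of_birationalClosure_eq_top A C K h
  -- A central prime over p must avoid every s² + b with s ∉ p. Conversely, an ideal maximal among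
  -- those disjoint from this multiplicative set turns out to be central.
  let T : Submonoid C :=
    { carrier := {c | ∃ s ∉ p, ∃ b : K, IsSumSq b ∧ algebraMap C K c = algebraMap A K s ^ 2 + b}
      one_mem' := ⟨1, p.primeCompl.one_mem, 0, .zero, by simp⟩
      mul_mem' := by
        rintro x y ⟨s, hs, b, hb, hx⟩ ⟨t, ht, d, hd, hy⟩
        refine ⟨s * t, p.primeCompl.mul_mem hs ht,
          algebraMap A K s ^ 2 * d + algebraMap A K t ^ 2 * b + b * d,
          ((isSumSq_sq_mul _ hd).add (isSumSq_sq_mul _ hb)).add (hb.mul hd), ?_⟩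
        rw [map_mul, hx, hy, map_mul]; ring }
  have hdisj : Disjoint (p.map (algebraMap A C) : Set C) T := by
    rw [Set.disjoint_left]
    rintro c hc ⟨s, hs, b, hb, hcb⟩
    exact hs (IsCentralIdeal.mem_of_sq_add_mem_map p hp hb hc hcb)
  obtain ⟨P, hIP, hP⟩ := zorn_le_nonempty₀ {P : Ideal C | Disjoint (P : Set C) T} (by
    intro c hc hc' x hx
    refine ⟨sSup c, Set.disjoint_left.mpr fun y hy ↦ ?_, fun _ ↦ le_sSup⟩
    have : Nonempty c := ⟨⟨x, hx⟩⟩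
    obtain ⟨q, hq⟩ := (Submodule.mem_iSup_of_directed _ hc'.directed).mp (sSup_eq_iSup' c ▸ hy)
    exact Set.disjoint_left.mp (hc q.2) hq) _ hdisj
  have hPT : Disjoint (P : Set C) T := hP.1
  have hPp : P.IsPrime :=
    Ideal.isPrime_of_maximally_disjoint P T hPT fun J hJ ↦ hP.not_prop_of_gt hJ
  refine ⟨P, hPp, ?_, le_antisymm (fun s hs ↦ ?_) (Ideal.map_le_iff_le_comap.mp hIP)⟩
  · rw [isCentralIdeal_iff K]
    intro a b hb c hc hcb
    by_contra ha
    have hlt : ¬ Disjoint ((P ⊔ Ideal.span {a} : Ideal C) : Set C) T :=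
      hP.not_prop_of_gt (Submodule.lt_sup_iff_notMem.mpr ha)
    obtain ⟨t, ht, hT⟩ := Set.not_disjoint_iff.mp hlt
    obtain ⟨x, hx, z, hz, rfl⟩ := Submodule.mem_sup.mp ht
    obtain ⟨y, rfl⟩ := Ideal.mem_span_singleton'.mp hz
    obtain ⟨s, hs, d, hd, hxd⟩ := T.mul_mem hT hT
    -- If x + ya ∈ T, then (x + ya)² + y²b is still in T, since adding sums of squares preserves T.
    -- Substituting c - b for a² turns it into x(x + 2ya) + y²c, which lies in P.
    refine Set.disjoint_left.mp hPT
      (show x * (x + 2 * (y * a)) + y ^ 2 * c ∈ P from add_mem (P.mul_mem_right _ hx) (P.mul_mem_left _ hc))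
      ⟨s, hs, d + algebraMap C K y ^ 2 * b, hd.add (isSumSq_sq_mul _ hb), ?_⟩
    rw [← add_assoc, ← hxd, map_add, map_mul _ (y ^ 2), hcb]
    simp only [map_add, map_mul, map_pow, map_ofNat]
    ring
  · by_contra hsp
    refine Set.disjoint_left.mp hPT
      (show algebraMap A C s ^ 2 ∈ P from P.pow_mem_of_mem hs 2 two_pos) ⟨s, hsp, 0, .zero, ?_⟩
    rw [map_pow, ← IsScalarTower.algebraMap_apply A C K, add_zero]

end CentralIdeals

/-! ### The central gluing in terms of values at central primes. -/

section Gluing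

lemma algebraMapSubmonoid_primeCompl_le_nonZeroDivisors {A C : Type*} [CommRing A] [CommRing C]
    [IsDomain C] [Algebra A C] [FaithfulSMul A C] (p : Ideal A) [p.IsPrime] :
    Algebra.algebraMapSubmonoid C p.primeCompl ≤ nonZeroDivisors C := by
  rintro _ ⟨s, hs, rfl⟩
  refine mem_nonZeroDivisors_of_ne_zero ?_
  rw [Ne, map_eq_zero_iff _ (FaithfulSMul.algebraMap_injective A C)]
  rintro rfl
  exact hs p.zero_mem

/-- An element of an integral extension `C` of `A` belongs to the central gluing if and only if,
over each central prime ideal of `A`, it takes a common value at the central primes of `C`. -/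
theorem mem_centralGluing_iff {A C : Type*} [CommRing A] [IsDomain A] [CommRing C] [IsDomain C]
    [Algebra A C] [FaithfulSMul A C] [Algebra.IsIntegral A C] {c : C} :
    c ∈ centralGluing A C ↔ ∀ p : Ideal A, p.IsPrime → IsCentralIdeal p →
      ∃ s ∉ p, ∃ a : A, ∀ P : Ideal C, P.IsPrime → IsCentralIdeal P →
        P.comap (algebraMap A C) = p → algebraMap A C s * c - algebraMap A C a ∈ P := by
  refine forall_congr' fun p ↦ forall_congr' fun hp ↦ imp_congr_right fun _ ↦ ?_
  let M := p.primeCompl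
  let N := Algebra.algebraMapSubmonoid C M
  let Ap := Localization M
  let Cp := Localization N
  have hN : N ≤ nonZeroDivisors C := algebraMapSubmonoid_primeCompl_le_nonZeroDivisors p
  have : IsDomain Cp := IsLocalization.isDomain_localization hN
  have hunit {s : A} (hs : s ∉ p) : IsUnit (algebraMap C Cp (algebraMap A C s)) :=
    IsLocalization.map_units Cp (⟨_, Algebra.mem_algebraMapSubmonoid_of_mem ⟨s, hs⟩⟩ : N)
  have hcomap (Q : Ideal Cp) : (Q.comap (algebraMap Ap Cp)).comap (algebraMap A Ap) =
      (Q.comap (algebraMap C Cp)).comap (algebraMap A C) := by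
    rw [Ideal.comap_comap, Ideal.comap_comap, ← IsScalarTower.algebraMap_eq,
      ← IsScalarTower.algebraMap_eq]
  constructor
  · rintro ⟨u, hu⟩
    obtain ⟨a, s, rfl⟩ := IsLocalization.exists_mk'_eq M u
    refine ⟨s, s.2, a, fun P hP hPc hPp ↦ ?_⟩
    have hdisj : Disjoint (N : Set C) P := by
      rw [Set.disjoint_left]
      rintro _ ⟨t, ht, rfl⟩ htP
      exact ht (hPp ▸ htP)
    have hPC : (P.map (algebraMap C Cp)).comap (algebraMap C Cp) = P :=
      IsLocalization.under_map_of_isPrime_disjoint N Cp hP hdisj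
    have hprime : (P.map (algebraMap C Cp)).IsPrime :=
      IsLocalization.isPrime_of_isPrime_disjoint N Cp P hP hdisj
    -- The extension of P contracts to the maximal ideal of A_p, and C_p is integral over A_p.
    have hmax : (P.map (algebraMap C Cp)).IsMaximal := by
      refine Ideal.isMaximal_of_isIntegral_of_isMaximal_comap (R := Ap) _ ?_
      have : ((P.map (algebraMap C Cp)).comap (algebraMap Ap Cp)) =
          IsLocalRing.maximalIdeal Ap := by
        rw [← IsLocalization.AtPrime.map_eq_maximalIdeal p Ap,
          ← IsLocalization.map_under M Ap (Ideal.comap _ _)]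
        congr 1
        exact (hcomap _).trans (by rw [hPC, hPp])
      rw [this]
      exact IsLocalRing.maximalIdeal.isMaximal _
    have hmem := (Submodule.mem_sInf.mp hu) _ ⟨hmax,
      (isCentralIdeal_comap_iff_of_isLocalization N hN _).mp (hPC.symm ▸ hPc)⟩
    rw [← hPC, Ideal.mem_comap]
    have := Ideal.mul_mem_left _ (algebraMap C Cp (algebraMap A C s)) hmem
    convert this using 1
    rw [mul_sub, map_sub, map_mul, ← IsScalarTower.algebraMap_apply A C Cp,
      ← IsScalarTower.algebraMap_apply A C Cp, IsScalarTower.algebraMap_apply A Ap Cp s,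
      ← map_mul, IsLocalization.mk'_spec', IsScalarTower.algebraMap_apply A Ap Cp a]
  · rintro ⟨s, hs, a, h⟩
    -- The common value is a/s. By integrality a maximal ideal Q of C_p lies over the maximal ideal
    -- of A_p, so its trace on C lies over p and the hypothesis applies to it.
    refine ⟨IsLocalization.mk' Ap a (⟨s, hs⟩ : M), Submodule.mem_sInf.mpr ?_⟩
    intro (Q : Ideal Cp) ⟨hQ, hQc⟩
    have hmem := h (Q.comap (algebraMap C Cp)) (Ideal.comap_isPrime _ _)
      ((isCentralIdeal_comap_iff_of_isLocalization N hN _).mpr hQc) (by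
        rw [← hcomap]
        have : (Q.comap (algebraMap Ap Cp)).IsMaximal :=
          Ideal.isMaximal_comap_of_isIntegral_of_isMaximal Q
        rw [IsLocalRing.eq_maximalIdeal this]
        exact IsLocalization.AtPrime.under_maximalIdeal Ap p)
    rw [← Ideal.unit_mul_mem_iff_mem Q (hunit hs)]
    rw [Ideal.mem_comap] at hmem
    convert hmem using 1
    rw [mul_sub, map_sub, map_mul, ← IsScalarTower.algebraMap_apply A C Cp,
      ← IsScalarTower.algebraMap_apply A C Cp, IsScalarTower.algebraMap_apply A Ap Cp s,
      ← map_mul, IsLocalization.mk'_spec' Ap a (⟨s, hs⟩ : M),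
      IsScalarTower.algebraMap_apply A Ap Cp a]

variable {A B : Type*} [CommRing A] [CommRing B] [Algebra A B]

instance : Algebra.IsIntegral A (integralBirationalClosure A B) where
  isIntegral x := by
    rw [← isIntegral_algebraMap_iff (B := B) Subtype.val_injective]
    exact x.2.1

lemma mem_centralSeminormalization_iff (hA : IsRealDomain A) {b : B} :
    b ∈ centralSeminormalization A B ↔
      ∃ hb : b ∈ integralBirationalClosure A B,
        (⟨b, hb⟩ : integralBirationalClosure A B) ∈ centralGluing A _ := by
  rw [centralSeminormalization, if_pos hA, Subalgebra.mem_map]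
  exact ⟨fun ⟨x, hx, h⟩ ↦ h ▸ ⟨x.2, hx⟩, fun ⟨hb, h⟩ ↦ ⟨_, h, rfl⟩⟩

lemma centralSeminormalization_le_integralClosure :
    centralSeminormalization A B ≤ integralClosure A B := by
  intro b hb
  by_cases hA : IsRealDomain A
  · exact ((mem_centralSeminormalization_iff hA).mp hb).1.1
  · rwa [centralSeminormalization, if_neg hA] at hb

end Gluing

/-! ### Subextensions of the central seminormalization and their central primes. -/

section Subintegral

lemma isIntegral_of_algebraMap_mem_integralClosure
    {A C B : Type*} [CommRing A] [CommRing C] [CommRing B] [Algebra A C] [Algebra C B]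
    [FaithfulSMul C B] [Algebra A B] [IsScalarTower A C B]
    (hC : ∀ c : C, algebraMap C B c ∈ integralClosure A B) : Algebra.IsIntegral A C where
  isIntegral c := (isIntegral_algebraMap_iff (FaithfulSMul.algebraMap_injective C B)).mp (hC c)

lemma birationalClosure_eq_top_of_algebraMap_mem
    {A C B : Type*} [CommRing A] [CommRing C] [CommRing B] [Algebra A C] [Algebra C B]
    [FaithfulSMul C B] [Algebra A B] [IsScalarTower A C B]
    (hC : ∀ c : C, algebraMap C B c ∈ birationalClosure A B) : birationalClosure A C = ⊤ := by
  refine Algebra.eq_top_iff.mpr fun c ↦ ?_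
  obtain ⟨a, s, hs, h⟩ := hC c
  refine ⟨a, s, hs, FaithfulSMul.algebraMap_injective C B ?_⟩
  rwa [map_mul, ← IsScalarTower.algebraMap_apply, ← IsScalarTower.algebraMap_apply]

variable {A C B : Type*} [CommRing A] [IsDomain A] [CommRing C] [IsDomain C] [CommRing B]
  [Algebra A C] [FaithfulSMul A C] [Algebra C B] [FaithfulSMul C B]
  [Algebra A B] [IsScalarTower A C B]

/-- An integral extension of a real domain which is injective and equiresidual on central primes
lands in the central seminormalization. -/
theorem algebraMap_mem_centralSeminormalization [IsDomain B] [Algebra.IsIntegral A C]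
    (hA : IsRealDomain A)
    (hinj : ∀ P Q : Ideal C, P.IsPrime → Q.IsPrime → IsCentralIdeal P → IsCentralIdeal Q →
      P.comap (algebraMap A C) = Q.comap (algebraMap A C) → P = Q)
    (hex : ∀ p : Ideal A, p.IsPrime → IsCentralIdeal p → ∃ P : Ideal C, P.IsPrime ∧
      IsCentralIdeal P ∧ P.comap (algebraMap A C) = p)
    (hres : ∀ P : Ideal C, P.IsPrime → IsCentralIdeal P → ∀ c : C, ∃ s : A,
      algebraMap A C s ∉ P ∧ ∃ a : A, algebraMap A C s * c - algebraMap A C a ∈ P) (c : C) :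
    algebraMap C B c ∈ centralSeminormalization A B := by
  have hCB := FaithfulSMul.algebraMap_injective C B
  have : FaithfulSMul A B := .trans A C B
  have hmem (c : C) : algebraMap C B c ∈ integralBirationalClosure A B := by
    refine ⟨(Algebra.IsIntegral.isIntegral (R := A) c).algebraMap, ?_⟩
    -- Birationality comes from the generic point: (0) is central because A is real, the prime above
    -- it is (0) by integrality, and equiresiduality there says that the fraction fields agree.
    obtain ⟨P, hP, hPc, hP0⟩ := hex ⊥ Ideal.isPrime_bot hA.isCentralIdeal_bot
    obtain rfl : P = ⊥ := Ideal.eq_bot_of_comap_eq_bot (R := A) hP0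
    obtain ⟨s, hs, a, ha⟩ := hres ⊥ hP hPc c
    refine ⟨a, s, mem_nonZeroDivisors_of_ne_zero (by rintro rfl; simp at hs), ?_⟩
    rw [Ideal.mem_bot, sub_eq_zero] at ha
    rw [IsScalarTower.algebraMap_apply A C B, IsScalarTower.algebraMap_apply A C B, ← ha, map_mul]
  let φ : C →+* integralBirationalClosure A B := (algebraMap C B).codRestrict _ hmem
  have hφ : Function.Injective φ := fun x y h ↦ hCB congr(($h : B))
  have hφA (a : A) : φ (algebraMap A C a) = algebraMap A _ a :=
    Subtype.ext (IsScalarTower.algebraMap_apply A C B a).symm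
  refine (mem_centralSeminormalization_iff hA).mpr ⟨hmem c, mem_centralGluing_iff.mpr ?_⟩
  intro p hp hpc
  obtain ⟨Q, hQ, hQc, rfl⟩ := hex p hp hpc
  obtain ⟨s, hs, a, ha⟩ := hres Q hQ hQc c
  refine ⟨s, hs, a, fun P hP hPc hPQ ↦ ?_⟩
  have hcomp : φ.comp (algebraMap A C) = algebraMap A _ := RingHom.ext hφA
  -- All central primes of the integral birational closure over p have the same trace Q on C, so the
  -- value of c at Q is its value at each of them.
  have : P.comap φ = Q := hinj _ _ (Ideal.comap_isPrime _ _) hQ (hPc.comap hφ) hQc (by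
    rw [Ideal.comap_comap, hcomp, hPQ])
  rw [← this, Ideal.mem_comap, map_sub, map_mul, hφA, hφA] at ha
  exact ha

/-- A subextension of the central seminormalization is bijective on central primes. -/
theorem exists_isCentralIdeal_comap_eq (hA : IsRealDomain A)
    (hC : ∀ c : C, algebraMap C B c ∈ centralSeminormalization A B)
    (p : Ideal A) [p.IsPrime] (hp : IsCentralIdeal p) :
    ∃ P : Ideal C, P.IsPrime ∧ IsCentralIdeal P ∧ P.comap (algebraMap A C) = p := by
  have hmem (c : C) := ((mem_centralSeminormalization_iff hA).mp (hC c)).1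
  have := isIntegral_of_algebraMap_mem_integralClosure (A := A) fun c ↦ (hmem c).1
  exact hp.exists_isPrime_comap_eq (birationalClosure_eq_top_of_algebraMap_mem (B := B)
    fun c ↦ (hmem c).2) p

/-- In a subextension `C` of the central seminormalization, every element takes at the central
primes over a given central prime of `A` a common value, which is rational over `A`. -/
theorem exists_forall_sub_mem_of_isCentralIdeal [IsDomain B]
    (hA : IsRealDomain A)
    (hC : ∀ c : C, algebraMap C B c ∈ centralSeminormalization A B)
    (p : Ideal A) [p.IsPrime] (hp : IsCentralIdeal p) (c : C) :
    ∃ s ∉ p, ∃ a : A, ∀ P : Ideal C, P.IsPrime → IsCentralIdeal P →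
      P.comap (algebraMap A C) = p → algebraMap A C s * c - algebraMap A C a ∈ P := by
  have hmem (c : C) := ((mem_centralSeminormalization_iff hA).mp (hC c)).1
  have : FaithfulSMul A B := .trans A C B
  let φ : C →+* integralBirationalClosure A B := (algebraMap C B).codRestrict _ hmem
  have hφ : Function.Injective φ := fun x y h ↦
    FaithfulSMul.algebraMap_injective C B congr(($h : B))
  have hφA (a : A) : φ (algebraMap A C a) = algebraMap A _ a :=
    Subtype.ext (IsScalarTower.algebraMap_apply A C B a).symm
  have hcomp : φ.comp (algebraMap A C) = algebraMap A _ := RingHom.ext hφA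
  let := φ.toAlgebra
  have : FaithfulSMul C (integralBirationalClosure A B) :=
    (faithfulSMul_iff_algebraMap_injective _ _).mpr hφ
  have : IsScalarTower A C (integralBirationalClosure A B) := .of_algebraMap_eq' hcomp.symm
  have : Algebra.IsIntegral C (integralBirationalClosure A B) := .tower_top A
  have hbir : birationalClosure C (integralBirationalClosure A B) = ⊤ := by
    refine Algebra.eq_top_iff.mpr fun x ↦ ?_
    obtain ⟨a, s, hs, h⟩ := x.2.2
    refine ⟨algebraMap A C a, algebraMap A C s, mem_nonZeroDivisors_of_ne_zero ?_, ?_⟩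
    · rw [Ne, map_eq_zero_iff _ (FaithfulSMul.algebraMap_injective A C)]
      exact nonZeroDivisors.ne_zero hs
    · rw [← IsScalarTower.algebraMap_apply, ← IsScalarTower.algebraMap_apply]
      exact Subtype.ext h
  obtain ⟨_, hc⟩ := (mem_centralSeminormalization_iff hA).mp (hC c)
  obtain ⟨s, hs, a, h⟩ := mem_centralGluing_iff.mp hc p ‹_› hp
  refine ⟨s, hs, a, fun P hP hPc hPp ↦ ?_⟩
  -- The gluing condition speaks only of central primes of the integral birational closure; lying
  -- over, applied over C, brings it down to P.
  obtain ⟨Q, hQ, hQc, rfl⟩ := hPc.exists_isPrime_comap_eq hbir P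
  have := h Q hQ hQc (by rw [← hPp, Ideal.comap_comap, ← IsScalarTower.algebraMap_eq])
  rw [Ideal.mem_comap, map_sub, map_mul]
  rw [← IsScalarTower.algebraMap_apply, ← IsScalarTower.algebraMap_apply]
  exact this

/-- An element of P has value 0 at P, hence at Q, because the two values coincide. Exchanging P and
Q gives injectivity on central primes. -/
theorem le_of_comap_eq_of_isCentralIdeal [IsDomain B] (hA : IsRealDomain A)
    (hC : ∀ c : C, algebraMap C B c ∈ centralSeminormalization A B)
    {P Q : Ideal C} (hP : P.IsPrime) (hQ : Q.IsPrime) (hPc : IsCentralIdeal P)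
    (hQc : IsCentralIdeal Q) (h : P.comap (algebraMap A C) = Q.comap (algebraMap A C)) :
    P ≤ Q := by
  intro c hcP
  have hpc : IsCentralIdeal (Q.comap (algebraMap A C)) :=
    hQc.comap (FaithfulSMul.algebraMap_injective A C)
  obtain ⟨s, hs, a, hsa⟩ := exists_forall_sub_mem_of_isCentralIdeal hA hC _ hpc c
  have ha : a ∈ Q.comap (algebraMap A C) := by
    rw [← h, Ideal.mem_comap]
    exact (Submodule.sub_mem_iff_right _ (P.mul_mem_left _ hcP)).mp (hsa P hP hPc h)
  exact (hQ.mem_or_mem ((Submodule.sub_mem_iff_left Q (Ideal.mem_comap.mp ha)).mp (hsa Q hQ hQc rfl))).resolve_left hs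

end Subintegral

/-! ### Localization of the central gluing. -/

section Localization

variable {A A' C C' : Type*} [CommRing A] [IsDomain A] [CommRing A'] [IsDomain A'] [CommRing C]
  [IsDomain C] [CommRing C'] [IsDomain C'] [Algebra A A'] [Algebra C C'] [Algebra A C]
  [FaithfulSMul A C] [Algebra.IsIntegral A C] [Algebra A' C'] [FaithfulSMul A' C']
  [Algebra.IsIntegral A' C'] [Algebra A C'] [IsScalarTower A C C'] [IsScalarTower A A' C']

theorem algebraMap_mem_centralGluing_of_isLocalization (M : Submonoid A)
    (hM : M ≤ nonZeroDivisors A) [IsLocalization M A']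
    [IsLocalization (Algebra.algebraMapSubmonoid C M) C'] {c : C} (hc : c ∈ centralGluing A C) :
    algebraMap C C' c ∈ centralGluing A' C' := by
  have hN : Algebra.algebraMapSubmonoid C M ≤ nonZeroDivisors C :=
    map_le_nonZeroDivisors_of_injective _ (FaithfulSMul.algebraMap_injective A C) hM
  refine mem_centralGluing_iff.mpr fun p hp hpc ↦ ?_
  obtain ⟨s, hs, a, h⟩ := mem_centralGluing_iff.mp hc (p.comap (algebraMap A A'))
    (Ideal.comap_isPrime _ _) ((isCentralIdeal_comap_iff_of_isLocalization M hM p).mpr hpc)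
  refine ⟨algebraMap A A' s, hs, algebraMap A A' a, fun P hP hPc hPp ↦ ?_⟩
  have := h (P.comap (algebraMap C C')) (Ideal.comap_isPrime _ _)
    ((isCentralIdeal_comap_iff_of_isLocalization _ hN P).mpr hPc) (by
      rw [← hPp, Ideal.comap_comap, Ideal.comap_comap, ← IsScalarTower.algebraMap_eq,
        ← IsScalarTower.algebraMap_eq])
  simpa only [Ideal.mem_comap, map_sub, map_mul, ← IsScalarTower.algebraMap_apply] using this

/-- The central primes of A containing f are invisible in A_f. The extra factor f makes the value 0
at them; the remaining ones survive in A_f, where the hypothesis applies. -/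
theorem mul_mem_centralGluing_of_isLocalization (f : A) (hf : f ≠ 0)
    [IsLocalization.Away f A'] [IsLocalization.Away (algebraMap A C f) C'] {c : C}
    (hc : algebraMap C C' c ∈ centralGluing A' C') :
    algebraMap A C f * c ∈ centralGluing A C := by
  have hfC : algebraMap A C f ≠ 0 := by
    rwa [Ne, map_eq_zero_iff _ (FaithfulSMul.algebraMap_injective A C)]
  have hM : Submonoid.powers f ≤ nonZeroDivisors A := powers_le_nonZeroDivisors_of_noZeroDivisors hf
  have hN : Submonoid.powers (algebraMap A C f) ≤ nonZeroDivisors C :=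
    powers_le_nonZeroDivisors_of_noZeroDivisors hfC
  refine mem_centralGluing_iff.mpr fun p hp hpc ↦ ?_
  by_cases hfp : f ∈ p
  · refine ⟨1, p.primeCompl.one_mem, 0, fun P hP hPc hPp ↦ ?_⟩
    rw [map_one, one_mul, map_zero, sub_zero]
    exact P.mul_mem_right _ (show f ∈ P.comap (algebraMap A C) from hPp ▸ hfp)
  have hdisj : Disjoint (Submonoid.powers f : Set A) p := by
    rwa [Ideal.disjoint_powers_iff_notMem _ hp.isRadical]
  have hp' := IsLocalization.isPrime_of_isPrime_disjoint _ A' p hp hdisj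
  have hpp' : (p.map (algebraMap A A')).comap (algebraMap A A') = p :=
    IsLocalization.under_map_of_isPrime_disjoint _ A' hp hdisj
  obtain ⟨s', hs', a', h⟩ := mem_centralGluing_iff.mp hc (p.map (algebraMap A A')) hp'
    ((isCentralIdeal_comap_iff_of_isLocalization _ hM _).mp (hpp'.symm ▸ hpc))
  obtain ⟨⟨s, t⟩, hst⟩ := IsLocalization.surj (Submonoid.powers f) s'
  obtain ⟨⟨a, u⟩, hau⟩ := IsLocalization.surj (Submonoid.powers f) a'
  have hut (v : Submonoid.powers f) : (v : A) ∉ p := fun hv ↦ Set.disjoint_left.mp hdisj v.2 hv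
  have hs : s ∉ p := by
    intro hs
    have : s' * algebraMap A A' t ∈ p.map (algebraMap A A') := hst ▸ Ideal.mem_map_of_mem _ hs
    exact hut t (hpp'.le ((hp'.mem_or_mem this).resolve_left hs'))
  -- With s' = s/t and a' = a/u, the relation s'c - a' ∈ P' is multiplied by ftu.
  refine ⟨s * u, p.primeCompl.mul_mem hs (hut u), f * (a * t), fun P hP hPc hPp ↦ ?_⟩
  have hdisjP : Disjoint (Submonoid.powers (algebraMap A C f) : Set C) P := by
    rw [Ideal.disjoint_powers_iff_notMem _ hP.isRadical]
    exact fun h ↦ hfp (hPp ▸ h)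
  have hPP' : (P.map (algebraMap C C')).comap (algebraMap C C') = P :=
    IsLocalization.under_map_of_isPrime_disjoint _ C' hP hdisjP
  have := h (P.map (algebraMap C C')) (IsLocalization.isPrime_of_isPrime_disjoint _ C' P hP hdisjP)
    ((isCentralIdeal_comap_iff_of_isLocalization _ hN _).mp (hPP'.symm ▸ hPc)) (by
      rw [← IsLocalization.map_under (Submonoid.powers f) A' (Ideal.comap _ _)]
      congr 1
      rw [Ideal.under, Ideal.comap_comap, ← IsScalarTower.algebraMap_eq,
        IsScalarTower.algebraMap_eq A C C', ← Ideal.comap_comap, hPP', hPp])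
  rw [← hPP', Ideal.mem_comap]
  have := Ideal.mul_mem_left _ (algebraMap A C' (f * t * u)) this
  convert this using 1
  have h₁ := congr(algebraMap A' C' $hst)
  have h₂ := congr(algebraMap A' C' $hau)
  simp only [map_sub, map_mul, ← IsScalarTower.algebraMap_apply] at h₁ h₂ ⊢
  linear_combination (algebraMap A C' f * algebraMap A C' u * algebraMap C C' c) * (-h₁) +
    (algebraMap A C' f * algebraMap A C' t) * h₂

end Localization

/-! ### Compatibility of the central seminormalization with inverting one element. -/

section Seminormalization

lemma isRealDomain_iff_of_isLocalization {A A' : Type*} [CommRing A] [IsDomain A]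
    [CommRing A'] [IsDomain A'] [Algebra A A'] (M : Submonoid A) (hM : M ≤ nonZeroDivisors A)
    [IsLocalization M A'] : IsRealDomain A ↔ IsRealDomain A' := by
  have : FaithfulSMul A A' := (faithfulSMul_iff_algebraMap_injective A A').mpr
    (IsLocalization.injective A' hM)
  have := isFractionRing_of_birationalClosure_eq_top A A' (FractionRing A')
    (birationalClosure_eq_top_of_isLocalization M hM)
  rw [isRealDomain_iff (FractionRing A'), isRealDomain_iff (FractionRing A')]

variable {A A' B B' : Type*} [CommRing A] [CommRing A'] [CommRing B] [CommRing B']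
  [Algebra A A'] [Algebra B B'] [Algebra A B] [Algebra A' B']
  [Algebra A B'] [IsScalarTower A B B'] [IsScalarTower A A' B']

lemma isIntegral_algebraMap_of_isScalarTower {b : B} (hb : IsIntegral A b) :
    IsIntegral A' (algebraMap B B' b) :=
  (hb.algebraMap (B := B')).tower_top

lemma algebraMap_mem_integralBirationalClosure [IsDomain A] [IsDomain A']
    (hi : Function.Injective (algebraMap A A')) {b : B}
    (hb : b ∈ integralBirationalClosure A B) :
    algebraMap B B' b ∈ integralBirationalClosure A' B' := by
  obtain ⟨hbi, a, s, hs, h⟩ := hb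
  refine ⟨isIntegral_algebraMap_of_isScalarTower hbi, algebraMap A A' a, algebraMap A A' s,
    map_mem_nonZeroDivisors _ hi hs, ?_⟩
  simpa only [map_mul, ← IsScalarTower.algebraMap_apply] using congr(algebraMap B B' $h)

lemma injective_algebraMap_of_away {A B B' : Type*} [CommRing A] [CommRing B] [IsDomain B]
    [CommRing B'] [Algebra A B] [FaithfulSMul A B] [Algebra B B'] (f : A) (hf : f ≠ 0)
    [IsLocalization.Away (algebraMap A B f) B'] : Function.Injective (algebraMap B B') := by
  refine IsLocalization.injective B' (M := .powers (algebraMap A B f))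
    (powers_le_nonZeroDivisors_of_noZeroDivisors ?_)
  rwa [Ne, map_eq_zero_iff _ (FaithfulSMul.algebraMap_injective A B)]

variable [IsDomain B] [FaithfulSMul A B]

section Away

variable (f : A) (hf : f ≠ 0) [IsLocalization.Away f A'] [IsLocalization.Away (algebraMap A B f) B']

include hf

/-- One power of f makes x integral over A and another brings it into B; their product does both. -/
lemma exists_mem_integralClosure_of_away {x : B'} (hx : IsIntegral A' x) :
    ∃ n : ℕ, ∃ y ∈ integralClosure A B, algebraMap B B' y = algebraMap A B' f ^ n * x := by
  obtain ⟨⟨_, m, rfl⟩, hm⟩ :=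
    IsIntegral.exists_multiple_integral_of_isLocalization (Submonoid.powers f) x hx
  obtain ⟨⟨y, ⟨_, k, rfl⟩⟩, hy⟩ :=
    IsLocalization.surj (Submonoid.powers (algebraMap A B f)) x
  have hB : Function.Injective (algebraMap B B') := injective_algebraMap_of_away (A := A) f hf
  have key : algebraMap B B' (algebraMap A B f ^ m * y) = algebraMap A B' f ^ (m + k) * x := by
    rw [map_mul, ← hy, map_pow, map_pow, ← IsScalarTower.algebraMap_apply]; ring
  refine ⟨m + k, algebraMap A B f ^ m * y, (isIntegral_algebraMap_iff hB).mp ?_, key⟩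
  have : algebraMap A B' f ^ (m + k) * x = f ^ k • (f ^ m • x) := by
    rw [Algebra.smul_def, Algebra.smul_def, map_pow, map_pow]; ring
  rw [key, this]
  exact hm.smul _

variable [IsDomain A] [IsDomain A']

lemma exists_mem_integralBirationalClosure_of_away {x : B'}
    (hx : x ∈ integralBirationalClosure A' B') :
    ∃ n : ℕ, ∃ y ∈ integralBirationalClosure A B,
      algebraMap B B' y = algebraMap A B' f ^ n * x := by
  obtain ⟨n, y, hy, hyx⟩ := exists_mem_integralClosure_of_away (B := B) f hf hx.1
  obtain ⟨a', s', hs', h⟩ := hx.2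
  refine ⟨n, y, ⟨hy, ?_⟩, hyx⟩
  obtain ⟨⟨s, t⟩, hst⟩ := IsLocalization.surj (Submonoid.powers f) s'
  obtain ⟨⟨a, u⟩, hau⟩ := IsLocalization.surj (Submonoid.powers f) a'
  have hM : Submonoid.powers f ≤ nonZeroDivisors A := powers_le_nonZeroDivisors_of_noZeroDivisors hf
  have hB : Function.Injective (algebraMap B B') := injective_algebraMap_of_away (A := A) f hf
  have hA := IsLocalization.injective A' hM
  -- From s'x = a', s' = s/t, a' = a/u and y = f^n x one gets su·y = f^n·at.
  refine ⟨f ^ n * (a * t), s * u, mul_mem (mem_nonZeroDivisors_of_ne_zero ?_) (hM u.2),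
    hB ?_⟩
  · rintro rfl
    rw [map_zero] at hst
    have := mul_ne_zero (nonZeroDivisors.ne_zero hs')
      (nonZeroDivisors.ne_zero (map_mem_nonZeroDivisors _ hA (hM t.2)))
    exact this hst
  · have h₁ := congr(algebraMap A' B' $hst)
    have h₂ := congr(algebraMap A' B' $hau)
    simp only [map_mul, map_pow, ← IsScalarTower.algebraMap_apply] at h₁ h₂ ⊢
    rw [hyx, ← h₁, ← h₂, ← h]
    ring

lemma isLocalization_integralBirationalClosure_of_away
    [Algebra (integralBirationalClosure A B) (integralBirationalClosure A' B')]
    (h : ∀ x : integralBirationalClosure A B, (algebraMap (integralBirationalClosure A B)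
      (integralBirationalClosure A' B') x : B') = algebraMap B B' x) :
    IsLocalization.Away (algebraMap A (integralBirationalClosure A B) f)
      (integralBirationalClosure A' B') := by
  have hB : Function.Injective (algebraMap B B') := injective_algebraMap_of_away (A := A) f hf
  have hfA (n : ℕ) : (algebraMap (integralBirationalClosure A B) (integralBirationalClosure A' B')
      (algebraMap A (integralBirationalClosure A B) f ^ n) : B') = algebraMap A B' f ^ n := by
    rw [h, IsScalarTower.algebraMap_apply A B B', ← map_pow]
    simp
  refine ⟨?_, ?_, ?_⟩
  · rintro ⟨_, n, rfl⟩
    obtain ⟨g, hg⟩ := IsLocalization.map_units A' (⟨f ^ n, n, rfl⟩ : Submonoid.powers f)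
    refine .of_mul_eq_one (algebraMap A' _ (g⁻¹ : A'ˣ)) (Subtype.ext ?_)
    have := congr(algebraMap A' B' ($hg * (g⁻¹ : A'ˣ)))
    rw [Units.mul_inv, map_mul, map_one, ← IsScalarTower.algebraMap_apply, map_pow] at this
    exact (congr($(hfA n) * algebraMap A' B' (g⁻¹ : A'ˣ))).trans this.symm
  · intro x
    obtain ⟨n, y, hy, hyx⟩ := exists_mem_integralBirationalClosure_of_away (B := B) f hf x.2
    refine ⟨(⟨y, hy⟩, ⟨_, n, rfl⟩), Subtype.ext ?_⟩
    rw [h, hyx, mul_comm]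
    exact congr($(hfA n) * (x : B'))
  · intro x y hxy
    refine ⟨1, ?_⟩
    rw [Subtype.ext (hB (((h x).symm.trans congr(($hxy : B'))).trans (h y)))]

variable [IsDomain B'] [FaithfulSMul A' B']

lemma mem_centralGluing_of_away :
    (∀ (b : B) (hb : b ∈ integralBirationalClosure A B) (hb' : algebraMap B B' b ∈
        integralBirationalClosure A' B'), ⟨b, hb⟩ ∈ centralGluing A (integralBirationalClosure A B) →
        ⟨_, hb'⟩ ∈ centralGluing A' (integralBirationalClosure A' B')) ∧
      ∀ (b : B) (hb : b ∈ integralBirationalClosure A B) (hb' : algebraMap B B' b ∈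
        integralBirationalClosure A' B'),
        ⟨_, hb'⟩ ∈ centralGluing A' (integralBirationalClosure A' B') →
        algebraMap A _ f * ⟨b, hb⟩ ∈ centralGluing A (integralBirationalClosure A B) := by
  have hM : Submonoid.powers f ≤ nonZeroDivisors A := powers_le_nonZeroDivisors_of_noZeroDivisors hf
  have hA := IsLocalization.injective A' hM
  let φ : integralBirationalClosure A B →+* integralBirationalClosure A' B' :=
    ((algebraMap B B').comp (integralBirationalClosure A B).val.toRingHom).codRestrict _
      fun x ↦ algebraMap_mem_integralBirationalClosure (B := B) (B' := B') hA x.2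
  let := φ.toAlgebra
  let := (φ.comp (algebraMap A _)).toAlgebra
  have : IsScalarTower A (integralBirationalClosure A B) (integralBirationalClosure A' B') :=
    .of_algebraMap_eq' rfl
  have : IsScalarTower A A' (integralBirationalClosure A' B') := .of_algebraMap_eq fun a ↦ by
    refine Subtype.ext ?_
    exact (IsScalarTower.algebraMap_apply A B B' a).symm.trans
      (IsScalarTower.algebraMap_apply A A' B' a)
  have hloc : IsLocalization.Away (algebraMap A (integralBirationalClosure A B) f)
      (integralBirationalClosure A' B') :=
    isLocalization_integralBirationalClosure_of_away (B := B) (B' := B') f hf fun _ ↦ rfl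
  refine ⟨fun b hb hb' h ↦ ?_, fun b hb hb' h ↦ ?_⟩
  · have : IsLocalization (Algebra.algebraMapSubmonoid (integralBirationalClosure A B)
        (Submonoid.powers f)) (integralBirationalClosure A' B') := by
      rwa [Algebra.algebraMapSubmonoid_powers]
    exact algebraMap_mem_centralGluing_of_isLocalization (Submonoid.powers f) hM h
  · exact mul_mem_centralGluing_of_isLocalization (A' := A')
      (C' := integralBirationalClosure A' B') f hf h

/-- The central seminormalization commutes with localization. -/
theorem algebraMap_mem_centralSeminormalization_of_away {b : B}
    (hb : b ∈ centralSeminormalization A B) :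
    algebraMap B B' b ∈ centralSeminormalization A' B' := by
  have hM : Submonoid.powers f ≤ nonZeroDivisors A := powers_le_nonZeroDivisors_of_noZeroDivisors hf
  have hA := IsLocalization.injective A' hM
  have hiff := isRealDomain_iff_of_isLocalization (A' := A') _ hM
  by_cases h : IsRealDomain A
  · obtain ⟨hb', hbg⟩ := (mem_centralSeminormalization_iff h).mp hb
    exact (mem_centralSeminormalization_iff (hiff.mp h)).mpr
      ⟨algebraMap_mem_integralBirationalClosure hA hb',
        (mem_centralGluing_of_away f hf).1 b hb' _ hbg⟩
  · rw [centralSeminormalization, if_neg h] at hb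
    rw [centralSeminormalization, if_neg (mt hiff.mpr h)]
    exact isIntegral_algebraMap_of_isScalarTower hb

theorem exists_mem_centralSeminormalization_of_away {x : B'}
    (hx : x ∈ centralSeminormalization A' B') :
    ∃ n : ℕ, ∃ y ∈ centralSeminormalization A B,
      algebraMap B B' y = algebraMap A B' f ^ n * x := by
  have hM : Submonoid.powers f ≤ nonZeroDivisors A := powers_le_nonZeroDivisors_of_noZeroDivisors hf
  have hA := IsLocalization.injective A' hM
  have hiff := isRealDomain_iff_of_isLocalization (A' := A') _ hM
  by_cases h : IsRealDomain A
  · obtain ⟨hx', hxg⟩ := (mem_centralSeminormalization_iff (hiff.mp h)).mp hx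
    obtain ⟨n, y, hy, hyx⟩ := exists_mem_integralBirationalClosure_of_away (B := B) f hf hx'
    have hy' : algebraMap B B' y ∈ centralSeminormalization A' B' := by
      rw [hyx, IsScalarTower.algebraMap_apply A A' B', ← map_pow]
      exact mul_mem (Subalgebra.algebraMap_mem _ _) hx
    obtain ⟨hyi, hyg⟩ := (mem_centralSeminormalization_iff (hiff.mp h)).mp hy'
    -- The power f^n clears the denominators; one further f is the price of the gluing condition at
    -- the central primes containing f.
    refine ⟨n + 1, algebraMap A B f * y, (mem_centralSeminormalization_iff h).mpr
      ⟨mul_mem (Subalgebra.algebraMap_mem _ _) hy, (mem_centralGluing_of_away f hf).2 y hy hyi hyg⟩,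
      ?_⟩
    rw [map_mul, hyx, ← IsScalarTower.algebraMap_apply]
    ring
  · rw [centralSeminormalization, if_neg (mt hiff.mpr h)] at hx
    rw [centralSeminormalization, if_neg h]
    exact exists_mem_integralClosure_of_away (B := B) f hf hx

end Away

end Seminormalization

/-! ### Finiteness of integral closures. -/

section Finiteness

/-- The integral closure of a normal Noetherian domain of characteristic zero in a domain of
finite type over it is a finite module. -/
theorem finite_integralClosure_of_isIntegrallyClosed (P B : Type*) [CommRing P] [IsDomain P]
    [IsIntegrallyClosed P] [IsNoetherianRing P] [CharZero P] [CommRing B] [IsDomain B]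
    [Algebra P B] [FaithfulSMul P B] [Algebra.FiniteType P B] :
    Module.Finite P (integralClosure P B) := by
  let K := FractionRing P
  let B₁ := Localization (Algebra.algebraMapSubmonoid B (nonZeroDivisors P))
  have hle : Algebra.algebraMapSubmonoid B (nonZeroDivisors P) ≤ nonZeroDivisors B :=
    map_le_nonZeroDivisors_of_injective _ (FaithfulSMul.algebraMap_injective P B) le_rfl
  have : IsDomain B₁ := IsLocalization.isDomain_localization hle
  have : Algebra.FiniteType K B₁ := by
    have : Algebra.IsPushout P K B B₁ :=
      ((Algebra.isLocalization_iff_isPushout (nonZeroDivisors P) K).mp inferInstance).symm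
    exact .equiv (.baseChange K) (Algebra.IsPushout.equiv P K B B₁)
  -- B may be transcendental over P, so its generic fibre is specialized to a closed point. By the
  -- Nullstellensatz the residue field L is finite over K, and the classical finiteness theorem
  -- holds in L.
  obtain ⟨n, hn⟩ := Ideal.exists_maximal B₁
  let L := B₁ ⧸ n
  let : Field L := Ideal.Quotient.field n
  have : Module.Finite K L := finite_of_finite_type_of_isJacobsonRing K L
  have : CharZero K := charZero_of_injective_algebraMap (IsFractionRing.injective P K)
  have : Module.Finite P (integralClosure P L) := IsIntegralClosure.finite P K L _
  let ψ : B →ₐ[P] L := ((Ideal.Quotient.mkₐ P n).comp (IsScalarTower.toAlgHom P B B₁))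
  let φ : integralClosure P B →ₐ[P] integralClosure P L := ψ.mapIntegralClosure
  refine Module.Finite.of_injective φ.toLinearMap ?_
  change Function.Injective φ.toRingHom
  rw [RingHom.injective_iff_ker_eq_bot]
  -- In the integral closure, a domain integral over P, a nonzero ideal meets P nontrivially; but P
  -- embeds in L. So specialization loses no integral elements.
  refine Ideal.eq_bot_of_comap_eq_bot (R := P) ?_
  refine eq_bot_iff.mpr fun x hx ↦ ?_
  have h : algebraMap P L x = 0 := congr(($hx : L))
  rw [IsScalarTower.algebraMap_apply P K L] at h
  simpa using h

/-- The integral closure of a domain of finite type over a field of characteristic zero in a domain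
of finite type over it is a finite module. -/
theorem finite_integralClosure_of_finiteType (k A B : Type*) [Field k] [CharZero k] [CommRing A]
    [IsDomain A] [Algebra k A] [Algebra.FiniteType k A] [CommRing B] [IsDomain B]
    [Algebra A B] [FaithfulSMul A B] [Algebra.FiniteType A B] :
    Module.Finite A (integralClosure A B) := by
  -- Noether normalization replaces A by a polynomial ring, which is normal.
  obtain ⟨s, g, hg, hfin⟩ := exists_finite_inj_algHom_of_fg k A
  let P := MvPolynomial (Fin s) k
  let := g.toRingHom.toAlgebra
  let := ((algebraMap A B).comp g.toRingHom).toAlgebra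
  have : IsScalarTower P A B := .of_algebraMap_eq' rfl
  have : Module.Finite P A := hfin
  have : FaithfulSMul P A := (faithfulSMul_iff_algebraMap_injective _ _).mpr hg
  have : FaithfulSMul P B := .trans P A B
  have : Algebra.FiniteType P B := .trans (S := A) inferInstance inferInstance
  have := finite_integralClosure_of_isIntegrallyClosed P B
  let e : integralClosure A B →ₗ[P] integralClosure P B :=
    { toFun x := ⟨x, isIntegral_trans (A := A) _ x.2⟩
      map_add' _ _ := rfl
      map_smul' r x := by
        ext
        simp [Algebra.smul_def] }
  have : Module.Finite P (integralClosure A B) :=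
    Module.Finite.of_injective e fun x y h ↦ Subtype.ext congr(($h : B))
  exact Module.Finite.of_restrictScalars_finite P A _

/-- B will be the sections over an open that need not be affine, hence perhaps not of finite type
over A. It embeds into the coordinate ring B₁ of an affine open, which is. -/
theorem finite_subalgebra_of_le_integralClosure (k : Type*) {A B B₁ : Type*} [Field k]
    [CharZero k] [CommRing A]
    [IsDomain A] [Algebra k A] [Algebra.FiniteType k A] [CommRing B] [CommRing B₁] [IsDomain B₁]
    [Algebra A B] [Algebra A B₁] [FaithfulSMul A B₁] [Algebra.FiniteType A B₁]
    (ι : B →ₐ[A] B₁) (hι : Function.Injective ι) (S : Subalgebra A B)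
    (hS : S ≤ integralClosure A B) : Module.Finite A S := by
  have := finite_integralClosure_of_finiteType k A B₁
  have : IsNoetherianRing A := Algebra.FiniteType.isNoetherianRing k A
  refine Module.Finite.of_injective (ι.mapIntegralClosure.comp (Subalgebra.inclusion hS)).toLinearMap
    fun x y h ↦ Subtype.ext (hι congr(($h : B₁)))

end Finiteness

/-! ### Descent of finiteness; central points and residue fields on affine charts. -/

section Schemes

/-- Finiteness descends along dominant morphisms to integral separated schemes over a locally
Noetherian base. -/
theorem isFinite_of_isFinite_comp {S Z X : Scheme} [IsLocallyNoetherian X] [IsReduced Z]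
    (h : S ⟶ Z) (p : Z ⟶ X) [IsFinite (h ≫ p)] [IsSeparated p] [IsDominant h] : IsFinite p := by
  have : IsFinite h := IsFinite.of_comp h p
  have : Surjective h := surjective_of_isDominant_of_isClosed_range h h.isClosedMap.isClosed_range
  have : IsSchemeTheoreticallyDominant h := .of_isDominant h
  -- Artin–Tate: h is finite and injective on sections, so finite type descends from the source of h
  -- to Z over the Noetherian base.
  have : LocallyOfFiniteType p := by
    rw [locallyOfFiniteType_iff]
    intro U hU V hV e
    have e' : h ⁻¹ᵁ V ≤ (h ≫ p) ⁻¹ᵁ U := h.preimage_mono e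
    have hfin := IsFinite.finite_app (f := h) V hV
    have hft := LocallyOfFiniteType.finiteType_appLE (f := h ≫ p) hU (hV.preimage h) e'
    have hinj := h.app_injective V
    have hcomp : p.appLE U V e ≫ h.app V = (h ≫ p).appLE U (h ⁻¹ᵁ V) e' := by
      rw [Scheme.Hom.app_eq_appLE, Scheme.Hom.appLE_comp_appLE]
    rw [← hcomp] at hft
    have := IsLocallyNoetherian.component_noetherian (X := X) ⟨U, hU⟩
    algebraize [(p.appLE U V e).hom, (h.app V).hom, (h.app V).hom.comp (p.appLE U V e).hom]
    exact ⟨fg_of_fg_of_fg _ _ _ hft.1 hfin.1 hinj⟩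
  have : UniversallyClosed p := .of_comp_surjective h p
  have : IsProper p := {}
  -- Since h is surjective, each fibre of p is the image of a finite fibre of the composite.
  have : LocallyQuasiFinite p := .of_finite_preimage_singleton p fun x ↦ by
    rw [← Set.image_preimage_eq (p ⁻¹' {x}) h.surjective, ← Set.preimage_comp]
    refine Set.Finite.image _ ?_
    have := (h ≫ p).finite_preimage_singleton x
    simpa using! this
  exact .of_isProper_of_locallyQuasiFinite p

/-- Passing to the local ring shows that centrality of a point does not depend on the affine chart.
-/
lemma isCentralIdeal_primeIdealOf_iff {X : Scheme} [IsIntegral X] {U : X.Opens}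
    (hU : IsAffineOpen U) (x : U) :
    IsCentralIdeal (hU.primeIdealOf x).asIdeal ↔
      IsCentralIdeal (IsLocalRing.maximalIdeal (X.presheaf.stalk x.1)) := by
  let := X.presheaf.algebra_section_stalk x
  have := hU.isLocalization_stalk x
  have : Nonempty U := ⟨x⟩
  refine Iff.trans ?_ (isCentralIdeal_comap_iff_of_isLocalization (A := Γ(X, U))
    (hU.primeIdealOf x).asIdeal.primeCompl (Ideal.primeCompl_le_nonZeroDivisors _)
    (IsLocalRing.maximalIdeal (X.presheaf.stalk x.1)))
  rw [hU.primeIdealOf_eq_map_closedPoint]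
  rfl

lemma isCentralPoint_iff {X : Scheme} [IsIntegral X] {U : X.Opens} (hU : IsAffineOpen U) (x : U) :
    IsCentralPoint x.1 ↔ IsCentralIdeal (hU.primeIdealOf x).asIdeal := by
  refine ⟨fun ⟨V, hV, hx, h⟩ ↦ ?_, fun h ↦ ⟨U, hU, x.2, h⟩⟩
  rw [isCentralIdeal_primeIdealOf_iff] at h ⊢
  exact h

lemma evaluation_eq_zero_iff {X : Scheme} {U : X.Opens} (hU : IsAffineOpen U) (x : U)
    (f : Γ(X, U)) : X.evaluation U x.1 x.2 f = 0 ↔ f ∈ (hU.primeIdealOf x).asIdeal := by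
  rw [hU.primeIdealOf_eq_map_closedPoint]
  exact IsLocalRing.residue_eq_zero_iff _

lemma exists_evaluation_mul_eq {X : Scheme} {U : X.Opens} (hU : IsAffineOpen U) (x : U)
    (f : X.residueField x.1) : ∃ a s, X.evaluation U x.1 x.2 s ≠ 0 ∧
      X.evaluation U x.1 x.2 s * f = X.evaluation U x.1 x.2 a := by
  obtain ⟨f, rfl⟩ := X.residue_surjective _ f
  let := X.presheaf.algebra_section_stalk x
  have := hU.isLocalization_stalk x
  obtain ⟨⟨a, s⟩, h⟩ := IsLocalization.surj (hU.primeIdealOf x).asIdeal.primeCompl f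
  refine ⟨a, s, fun hs ↦ s.2 ((evaluation_eq_zero_iff hU x _).mp hs), ?_⟩
  have := congr(X.residue _ $h)
  rw [map_mul, mul_comm] at this
  exact this

/-- Elements of k(z) are quotients of values of sections, so surjectivity need only be tested on
such values. -/
lemma residueFieldMap_bijective_iff {Z X : Scheme} (p : Z ⟶ X) {U : X.Opens}
    (hU : IsAffineOpen U) (hV : IsAffineOpen (p ⁻¹ᵁ U)) (z : (p ⁻¹ᵁ U : Z.Opens)) :
    Function.Bijective (p.residueFieldMap z.1).hom ↔
      ∀ c : Γ(Z, p ⁻¹ᵁ U), ∃ s : Γ(X, U), p.app U s ∉ (hV.primeIdealOf z).asIdeal ∧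
        ∃ a : Γ(X, U), p.app U s * c - p.app U a ∈ (hV.primeIdealOf z).asIdeal := by
  have hz : p z.1 ∈ U := z.2
  have hnat (a : Γ(X, U)) := Scheme.evaluation_naturality_apply p z.1 hz a
  have hinj : Function.Injective (p.residueFieldMap z.1).hom := RingHom.injective _
  constructor
  · intro h c
    obtain ⟨f, hf⟩ := h.2 (Z.evaluation _ z.1 z.2 c)
    obtain ⟨a, s, hs, hsa⟩ := exists_evaluation_mul_eq hU ⟨p z.1, hz⟩ f
    refine ⟨s, ?_, a, ?_⟩
    · rw [← evaluation_eq_zero_iff, ← hnat]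
      exact fun h ↦ hs (hinj (h.trans (map_zero _).symm))
    · rw [← evaluation_eq_zero_iff, map_sub, map_mul, ← hnat, ← hnat, ← hsa, map_mul, sub_eq_zero]
      exact congr(_ * $hf.symm)
  · refine fun h ↦ ⟨hinj, ?_⟩
    have key (c : Γ(Z, p ⁻¹ᵁ U)) : Z.evaluation _ z.1 z.2 c ∈
        (p.residueFieldMap z.1).hom.fieldRange := by
      obtain ⟨s, hs, a, ha⟩ := h c
      rw [← evaluation_eq_zero_iff, ← hnat] at hs
      rw [← evaluation_eq_zero_iff, map_sub, map_mul, ← hnat, ← hnat, sub_eq_zero] at ha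
      rw [eq_div_of_mul_eq hs ((mul_comm _ _).trans ha)]
      exact div_mem ⟨_, rfl⟩ ⟨_, rfl⟩
    intro f
    obtain ⟨a, s, hs, hsa⟩ := exists_evaluation_mul_eq hV z f
    rw [eq_div_of_mul_eq hs ((mul_comm _ _).trans hsa)]
    exact div_mem (key a) (key s)

end Schemes

/-! ### Central subintegrality as a condition on sections. -/

section UniversalProperty

lemma primeIdealOf_injective {X : Scheme} {U : X.Opens} (hU : IsAffineOpen U) :
    Function.Injective hU.primeIdealOf := by
  intro x y h
  refine Subtype.ext ?_
  rw [← hU.fromSpec_primeIdealOf, h, hU.fromSpec_primeIdealOf]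

lemma exists_primeIdealOf_eq {X : Scheme} {U : X.Opens} (hU : IsAffineOpen U) (P : Ideal Γ(X, U))
    (hP : P.IsPrime) : ∃ x : U, (hU.primeIdealOf x).asIdeal = P := by
  have hx : hU.fromSpec ⟨P, hP⟩ ∈ U := by
    have : hU.fromSpec ⟨P, hP⟩ ∈ Set.range hU.fromSpec := ⟨_, rfl⟩
    rwa [hU.range_fromSpec] at this
  refine ⟨⟨_, hx⟩, ?_⟩
  rw [hU.fromSpec.isOpenEmbedding.injective (hU.fromSpec_primeIdealOf ⟨_, hx⟩)]

lemma comap_app_primeIdealOf {Z X : Scheme} (p : Z ⟶ X) {U : X.Opens}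
    (hU : IsAffineOpen U) (hV : IsAffineOpen (p ⁻¹ᵁ U)) (z : (p ⁻¹ᵁ U : Z.Opens)) :
    (hV.primeIdealOf z).asIdeal.comap (p.app U).hom = (hU.primeIdealOf ⟨p z.1, z.2⟩).asIdeal := by
  have := congr(PrimeSpectrum.asIdeal
    $(IsAffineOpen.comap_primeIdealOf_appLE U hU _ hV (le_refl (p ⁻¹ᵁ U)) z.2))
  rwa [← Scheme.Hom.app_eq_appLE] at this

lemma nonempty_preimage {Z X : Scheme} (p : Z ⟶ X) [IsDominant p] (U : X.Opens) [h : Nonempty U] :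
    Nonempty (p ⁻¹ᵁ U) := by
  obtain ⟨x, hx⟩ := h
  obtain ⟨_, hxU, z, rfl⟩ := p.denseRange.inter_open_nonempty U U.isOpen ⟨x, hx⟩
  exact ⟨⟨z, hxU⟩⟩

lemma app_injective_of_isDominant {Z X : Scheme} [IsReduced X] (p : Z ⟶ X) [IsDominant p]
    [QuasiCompact p] (U : X.Opens) : Function.Injective (p.app U).hom :=
  have : IsSchemeTheoreticallyDominant p := .of_isDominant p
  p.app_injective U

lemma subsingleton_sections_preimage {Y X : Scheme} (π : Y ⟶ X) (U : X.Opens)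
    (hU : ¬ Nonempty U) : Subsingleton Γ(Y, π ⁻¹ᵁ U) := by
  have : π ⁻¹ᵁ U = ⊥ := by
    ext y
    exact ⟨fun h ↦ hU ⟨⟨_, h⟩⟩, False.elim⟩
  rw [this]
  infer_instance

lemma mem_seminormalizationSections_of_isEmpty {Y X : Scheme} (π : Y ⟶ X) (U : X.Opens)
    (hU : ¬ Nonempty U) (b : Γ(Y, π ⁻¹ᵁ U)) : b ∈ seminormalizationSections π U := by
  have := subsingleton_sections_preimage π U hU
  rw [Subsingleton.elim b 0]
  exact zero_mem _

variable {X Y Z : Scheme} [IsIntegral X] [IsIntegral Y] [IsIntegral Z]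
  (q : Y ⟶ Z) (p : Z ⟶ X) [IsDominant q] [QuasiCompact q] [IsDominant p] [IsFinite p]

/-- A factorization through a centrally subintegral morphism has its sections in the central
seminormalization. -/
theorem app_mem_seminormalizationSections (hp : IsCentrallySubintegral p) {U : X.Opens}
    (hU : IsAffineOpen U) (c : Γ(Z, p ⁻¹ᵁ U)) :
    (q.app (p ⁻¹ᵁ U)).hom c ∈ seminormalizationSections (q ≫ p) U := by
  by_cases hne : Nonempty U; swap
  · exact mem_seminormalizationSections_of_isEmpty (q ≫ p) U hne _
  have hV : IsAffineOpen (p ⁻¹ᵁ U) := hU.preimage p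
  have := nonempty_preimage p U
  have := nonempty_preimage q (p ⁻¹ᵁ U)
  have hpi := app_injective_of_isDominant p U
  have hqi := app_injective_of_isDominant q (p ⁻¹ᵁ U)
  algebraize [(p.app U).hom, (q.app (p ⁻¹ᵁ U)).hom, (q.app (p ⁻¹ᵁ U)).hom.comp (p.app U).hom]
  have : Module.Finite Γ(X, U) Γ(Z, p ⁻¹ᵁ U) := IsFinite.finite_app (f := p) U hU
  have : FaithfulSMul Γ(X, U) Γ(Z, p ⁻¹ᵁ U) := (faithfulSMul_iff_algebraMap_injective _ _).mpr hpi
  have : FaithfulSMul Γ(Z, p ⁻¹ᵁ U) Γ(Y, q ⁻¹ᵁ p ⁻¹ᵁ U) :=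
    (faithfulSMul_iff_algebraMap_injective _ _).mpr hqi
  change algebraMap Γ(Z, p ⁻¹ᵁ U) Γ(Y, q ⁻¹ᵁ p ⁻¹ᵁ U) c ∈
    centralSeminormalization Γ(X, U) Γ(Y, q ⁻¹ᵁ p ⁻¹ᵁ U)
  -- Over a ring that is not real there are no central primes to compare, and finiteness of p
  -- suffices.
  by_cases hA : IsRealDomain Γ(X, U); swap
  · rw [centralSeminormalization, if_neg hA]
    exact (Algebra.IsIntegral.isIntegral (R := Γ(X, U)) c).algebraMap
  refine algebraMap_mem_centralSeminormalization hA ?_ ?_ ?_ c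
  · intro P Q hP hQ hPc hQc h
    obtain ⟨x, rfl⟩ := exists_primeIdealOf_eq hV P hP
    obtain ⟨y, rfl⟩ := exists_primeIdealOf_eq hV Q hQ
    replace h := ((comap_app_primeIdealOf p hU hV x).symm.trans h).trans
      (comap_app_primeIdealOf p hU hV y)
    have hxy := primeIdealOf_injective hU (PrimeSpectrum.ext h)
    rw [Subtype.ext (hp.bijOn.injOn ((isCentralPoint_iff hV x).mpr hPc)
      ((isCentralPoint_iff hV y).mpr hQc) congr(($hxy).1))]
  · intro P hP hPc
    obtain ⟨x, rfl⟩ := exists_primeIdealOf_eq hU P hP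
    obtain ⟨z, hz, hzx⟩ := hp.bijOn.surjOn ((isCentralPoint_iff hU x).mpr hPc)
    have hzU : p z ∈ U := hzx ▸ x.2
    refine ⟨(hV.primeIdealOf ⟨z, hzU⟩).asIdeal, inferInstance,
      (isCentralPoint_iff hV ⟨z, hzU⟩).mp hz, ?_⟩
    refine (comap_app_primeIdealOf p hU hV ⟨z, hzU⟩).trans ?_
    congr 2
    exact Subtype.ext hzx
  · intro P hP hPc
    obtain ⟨z, rfl⟩ := exists_primeIdealOf_eq hV P hP
    exact (residueFieldMap_bijective_iff p hU hV z).mp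
      (hp.equiresidual z.1 ((isCentralPoint_iff hV z).mpr hPc))

theorem isCentrallySubintegral_of_forall_app_mem
    (h : ∀ U : X.Opens, IsAffineOpen U → ∀ c : Γ(Z, p ⁻¹ᵁ U),
      (q.app (p ⁻¹ᵁ U)).hom c ∈ seminormalizationSections (q ≫ p) U) :
    IsCentrallySubintegral p := by
  have key (U : X.Opens) (hU : IsAffineOpen U) (hne : Nonempty U) :
      (∀ z : (p ⁻¹ᵁ U : Z.Opens), IsCentralPoint z.1 → IsCentralPoint (p z.1) ∧
        Function.Bijective (p.residueFieldMap z.1).hom ∧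
        ∀ y : (p ⁻¹ᵁ U : Z.Opens), IsCentralPoint y.1 → p y.1 = p z.1 → y = z) ∧
      ∀ x : U, IsCentralPoint x.1 → ∃ z, IsCentralPoint z ∧ p z = x.1 := by
    have hV : IsAffineOpen (p ⁻¹ᵁ U) := hU.preimage p
    have := nonempty_preimage p U
    have := nonempty_preimage q (p ⁻¹ᵁ U)
    have hpi := app_injective_of_isDominant p U
    have hqi := app_injective_of_isDominant q (p ⁻¹ᵁ U)
    have hmem := h U hU
    algebraize [(p.app U).hom, (q.app (p ⁻¹ᵁ U)).hom, (q.app (p ⁻¹ᵁ U)).hom.comp (p.app U).hom]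
    have : FaithfulSMul Γ(X, U) Γ(Z, p ⁻¹ᵁ U) :=
      (faithfulSMul_iff_algebraMap_injective _ _).mpr hpi
    have : FaithfulSMul Γ(Z, p ⁻¹ᵁ U) Γ(Y, q ⁻¹ᵁ p ⁻¹ᵁ U) :=
      (faithfulSMul_iff_algebraMap_injective _ _).mpr hqi
    change ∀ c, algebraMap Γ(Z, p ⁻¹ᵁ U) Γ(Y, q ⁻¹ᵁ p ⁻¹ᵁ U) c ∈
      centralSeminormalization Γ(X, U) Γ(Y, q ⁻¹ᵁ p ⁻¹ᵁ U) at hmem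
    have hcomap (z : (p ⁻¹ᵁ U : Z.Opens)) (hz : IsCentralPoint z.1) : IsCentralPoint (p z.1) := by
      have hzU : p z.1 ∈ U := z.2
      rw [isCentralPoint_iff hV] at hz
      refine (isCentralPoint_iff hU ⟨p z.1, hzU⟩).mpr ?_
      rw [← comap_app_primeIdealOf p hU hV z]
      exact hz.comap hpi
    -- A single central point in U already places the ring in the real case, where the gluing
    -- description is available.
    have hreal {x : X} (hxU : x ∈ U) (hx : IsCentralPoint x) : IsRealDomain Γ(X, U) :=
      ((isCentralPoint_iff hU ⟨x, hxU⟩).mp hx).isRealDomain (Ideal.IsPrime.ne_top inferInstance)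
    refine ⟨fun z hz ↦ ⟨hcomap z hz, ?_, fun y hy hyz ↦ ?_⟩, fun x hx ↦ ?_⟩
    · refine (residueFieldMap_bijective_iff p hU hV z).mpr fun c ↦ ?_
      have hzc := (isCentralPoint_iff hV z).mp hz
      obtain ⟨s, hs, a, hsa⟩ := exists_forall_sub_mem_of_isCentralIdeal (hreal z.2 (hcomap z hz))
        hmem _ (hzc.comap hpi) c
      exact ⟨s, hs, a, hsa _ inferInstance hzc rfl⟩
    · have hzc := (isCentralPoint_iff hV z).mp hz
      have hyc := (isCentralPoint_iff hV y).mp hy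
      have hA := hreal z.2 (hcomap z hz)
      have heq : (hV.primeIdealOf y).asIdeal.comap (p.app U).hom =
          (hV.primeIdealOf z).asIdeal.comap (p.app U).hom := by
        rw [comap_app_primeIdealOf p hU hV, comap_app_primeIdealOf p hU hV]
        congr 2
        exact Subtype.ext hyz
      refine primeIdealOf_injective hV (PrimeSpectrum.ext (le_antisymm ?_ ?_))
      · exact le_of_comap_eq_of_isCentralIdeal hA hmem inferInstance inferInstance hyc hzc heq
      · exact le_of_comap_eq_of_isCentralIdeal hA hmem inferInstance inferInstance hzc hyc heq.symm
    · have hx' := (isCentralPoint_iff hU x).mp hx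
      obtain ⟨P, hP, hPc, hPx⟩ := exists_isCentralIdeal_comap_eq (hreal x.2 hx) hmem
        (hU.primeIdealOf x).asIdeal hx'
      obtain ⟨z, rfl⟩ := exists_primeIdealOf_eq hV P hP
      have := (comap_app_primeIdealOf p hU hV z).symm.trans hPx
      exact ⟨z, (isCentralPoint_iff hV z).mpr hPc,
        congr(($(primeIdealOf_injective hU (PrimeSpectrum.ext this))).1)⟩
  have hcover (x : X) : ∃ U : X.Opens, IsAffineOpen U ∧ x ∈ U := by
    obtain ⟨_, ⟨U, hU, rfl⟩, hxU, -⟩ :=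
      X.isBasis_affineOpens.exists_subset_of_mem_open (Set.mem_univ x) isOpen_univ
    exact ⟨U, hU, hxU⟩
  refine ⟨inferInstance, ⟨fun z hz ↦ ?_, fun y hy z hz hyz ↦ ?_, fun x hx ↦ ?_⟩, fun z hz ↦ ?_⟩
  · obtain ⟨U, hU, hzU⟩ := hcover (p z)
    exact ((key U hU ⟨⟨_, hzU⟩⟩).1 ⟨z, hzU⟩ hz).1
  · obtain ⟨U, hU, hzU⟩ := hcover (p z)
    have hyU : p y ∈ U := hyz ▸ hzU
    exact congr(($(((key U hU ⟨⟨_, hzU⟩⟩).1 ⟨z, hzU⟩ hz).2.2 ⟨y, hyU⟩ hy hyz)).1)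
  · obtain ⟨U, hU, hxU⟩ := hcover x
    exact (key U hU ⟨⟨_, hxU⟩⟩).2 ⟨x, hxU⟩ hx
  · obtain ⟨U, hU, hzU⟩ := hcover (p z)
    exact ((key U hU ⟨⟨_, hzU⟩⟩).1 ⟨z, hzU⟩ hz).2.1

end UniversalProperty

/-! ### Morphisms from inclusions of sections, and their gluing. -/

section Descent

open Limits

lemma exists_ringHom_comp_eq {C D B : Type*} [CommRing C] [CommRing D] [CommRing B] (f : C →+* B)
    (i : D →+* B) (hi : Function.Injective i) (h : ∀ c, f c ∈ i.range) :
    ∃ g : C →+* D, i.comp g = f := by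
  have hb : Function.Bijective i.rangeRestrict :=
    ⟨fun x y h ↦ hi (congrArg Subtype.val h), i.rangeRestrict_surjective⟩
  let e := RingEquiv.ofBijective i.rangeRestrict hb
  refine ⟨e.symm.toRingHom.comp (f.codRestrict i.range h), RingHom.ext fun c ↦ ?_⟩
  exact congrArg Subtype.val (e.apply_symm_apply (f.codRestrict i.range h c))

variable {X Y Z S : Scheme} {π : Y ⟶ X} {j : Y ⟶ S} {ν : S ⟶ X} {q : Y ⟶ Z} {p : Z ⟶ X}

/-- The clause over all T pins f down on whatever comes from Y. It serves twice: for agreement on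
overlaps, and for the compatibility of the glued morphism with q. -/
lemma exists_hom_of_range_le [IsAffineHom p] (hj : j ≫ ν = π) (hq : q ≫ p = π)
    {U : X.Opens} (hU : IsAffineOpen U) (e : π ⁻¹ᵁ U ≤ j ⁻¹ᵁ ν ⁻¹ᵁ U)
    (e' : π ⁻¹ᵁ U ≤ q ⁻¹ᵁ p ⁻¹ᵁ U)
    (hinj : Function.Injective (j.appLE (ν ⁻¹ᵁ U) (π ⁻¹ᵁ U) e).hom)
    (hr : (q.appLE (p ⁻¹ᵁ U) (π ⁻¹ᵁ U) e').hom.range ≤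
      (j.appLE (ν ⁻¹ᵁ U) (π ⁻¹ᵁ U) e).hom.range) :
    ∃ f : (ν ⁻¹ᵁ U : S.Opens).toScheme ⟶ Z, f ≫ p = (ν ⁻¹ᵁ U).ι ≫ ν ∧
      ∀ (T : Scheme) (a : T ⟶ Y) (b : T ⟶ (ν ⁻¹ᵁ U : S.Opens)), a ≫ j = b ≫ (ν ⁻¹ᵁ U).ι →
        b ≫ f = a ≫ q := by
  have hV : IsAffineOpen (p ⁻¹ᵁ U) := hU.preimage p
  obtain ⟨g, hg⟩ := exists_ringHom_comp_eq (q.appLE (p ⁻¹ᵁ U) (π ⁻¹ᵁ U) e').hom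
    (j.appLE (ν ⁻¹ᵁ U) (π ⁻¹ᵁ U) e).hom hinj fun c ↦ hr ⟨c, rfl⟩
  have hg' : CommRingCat.ofHom g ≫ j.appLE (ν ⁻¹ᵁ U) (π ⁻¹ᵁ U) e =
      q.appLE (p ⁻¹ᵁ U) (π ⁻¹ᵁ U) e' := by
    ext1; exact hg
  have hmono : Mono (j.appLE (ν ⁻¹ᵁ U) (π ⁻¹ᵁ U) e) := ConcreteCategory.mono_of_injective _ hinj
  have hgp : p.app U ≫ CommRingCat.ofHom g = ν.app U := by
    rw [← cancel_mono (j.appLE (ν ⁻¹ᵁ U) (π ⁻¹ᵁ U) e), Category.assoc, hg',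
      Scheme.Hom.app_eq_appLE, Scheme.Hom.app_eq_appLE, Scheme.Hom.appLE_comp_appLE,
      Scheme.Hom.appLE_comp_appLE]
    subst hj
    simp_rw [hq]
  refine ⟨(ν ⁻¹ᵁ U).toSpecΓ ≫ Spec.map (CommRingCat.ofHom g) ≫ hV.fromSpec, ?_, ?_⟩
  · rw [Category.assoc, Category.assoc, ← IsAffineOpen.SpecMap_appLE_fromSpec p hU hV le_rfl,
      ← Scheme.Hom.app_eq_appLE, ← Spec.map_comp_assoc, hgp, Scheme.Hom.app_eq_appLE]
    simp
  · intro T a b hab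
    have hrange : Set.range a ⊆ Set.range (π ⁻¹ᵁ U).ι := by
      rw [Scheme.Opens.range_ι]
      rintro _ ⟨t, rfl⟩
      have : ν ((a ≫ j) t) ∈ U := by
        rw [hab]
        exact (b t).2
      rw [← hj]
      exact this
    let a' := IsOpenImmersion.lift (π ⁻¹ᵁ U).ι a hrange
    have ha' : a' ≫ (π ⁻¹ᵁ U).ι = a := IsOpenImmersion.lift_fac _ _ _
    have hb : b = a' ≫ j.resLE (ν ⁻¹ᵁ U) (π ⁻¹ᵁ U) e := by
      rw [← cancel_mono (ν ⁻¹ᵁ U).ι, ← hab, Category.assoc, Scheme.Hom.resLE_comp_ι, ← ha',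
        Category.assoc]
    rw [hb, ← ha', Category.assoc, ← Scheme.Opens.toSpecΓ_SpecMap_appLE_assoc,
      ← Spec.map_comp_assoc, hg', Scheme.Opens.toSpecΓ_SpecMap_appLE_assoc]
    simp

/-- The kernel ideal sheaf of j can be tested on the affine opens ν⁻¹(U), where its vanishing is the
assumed injectivity. -/
lemma isSchemeTheoreticallyDominant_of_injective (hj : j ≫ ν = π) [IsAffineHom ν] [QuasiCompact π]
    (e : ∀ U : X.Opens, π ⁻¹ᵁ U ≤ j ⁻¹ᵁ ν ⁻¹ᵁ U)
    (hinj : ∀ U : X.Opens, IsAffineOpen U →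
      Function.Injective (j.appLE (ν ⁻¹ᵁ U) (π ⁻¹ᵁ U) (e U)).hom) :
    QuasiCompact j ∧ IsSchemeTheoreticallyDominant j := by
  have : QuasiCompact (j ≫ ν) := hj ▸ inferInstance
  have : QuasiCompact j := .of_comp j ν
  refine ⟨this, ⟨Scheme.IdealSheafData.ext_of_iSup_eq_top
    (fun U : X.affineOpens ↦ ⟨ν ⁻¹ᵁ U.1, U.2.preimage _⟩)
    (TopologicalSpace.IsOpenCover.comap (iSup_affineOpens_eq_top _) _) fun U ↦ ?_⟩⟩
  simp only [Scheme.Hom.ker_apply, Scheme.IdealSheafData.ideal_bot, Pi.bot_apply]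
  rw [← RingHom.injective_iff_ker_eq_bot]
  intro x y hxy
  refine hinj U.1 U.2 ?_
  rw [Scheme.Hom.appLE, CommRingCat.hom_comp]
  exact congr((Y.presheaf.map _).hom $hxy)

lemma exists_hom_of_isOpenCover {ι : Type*} {W : ι → S.Opens} (hW : TopologicalSpace.IsOpenCover W)
    [IsReduced S] [IsSeparated p] [IsSchemeTheoreticallyDominant j] [QuasiCompact j]
    (f : ∀ i, (W i).toScheme ⟶ Z)
    (hfp : ∀ i, f i ≫ p = (W i).ι ≫ ν)
    (hfq : ∀ i (T : Scheme) (a : T ⟶ Y) (b : T ⟶ (W i).toScheme), a ≫ j = b ≫ (W i).ι →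
        b ≫ f i = a ≫ q) :
    ∃ h : S ⟶ Z, h ≫ p = ν ∧ j ≫ h = q := by
  have key (i k : ι) : pullback.fst (W i).ι (W k).ι ≫ f i = pullback.snd (W i).ι (W k).ι ≫ f k := by
    let g := pullback.fst (W i).ι (W k).ι ≫ (W i).ι
    have : IsReduced (pullback (W i).ι (W k).ι) := isReduced_of_isOpenImmersion g
    have hg : pullback.snd (W i).ι (W k).ι ≫ (W k).ι = g := pullback.condition.symm
    -- On a reduced overlap, two morphisms over X into a separated Z agree once they agree after the
    -- dominant base change of j.
    refine ext_of_isDominant_of_isSeparated p ?_ (pullback.snd j g) ?_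
    · rw [Category.assoc, Category.assoc, hfp, hfp, pullback.condition_assoc]
    · rw [← Category.assoc, ← Category.assoc, hfq i _ (pullback.fst j g), hfq k _ (pullback.fst j g)]
      · rw [Category.assoc, hg, pullback.condition]
      · rw [Category.assoc, pullback.condition]
  let 𝒰 := S.openCoverOfIsOpenCover W hW
  let h : S ⟶ Z := 𝒰.glueMorphisms f key
  have hf (i) : (W i).ι ≫ h = f i := 𝒰.ι_glueMorphisms _ _ _
  refine ⟨h, 𝒰.hom_ext _ _ fun (i : ι) ↦ ?_, ?_⟩
  · change (W i).ι ≫ h ≫ p = (W i).ι ≫ ν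
    rw [← Category.assoc, hf, hfp]
  · refine (Y.openCoverOfIsOpenCover (fun i ↦ j ⁻¹ᵁ W i) (hW.comap j.base.hom)).hom_ext _ _
      fun (i : ι) ↦ ?_
    change (j ⁻¹ᵁ W i).ι ≫ j ≫ h = (j ⁻¹ᵁ W i).ι ≫ q
    rw [← hfq i _ (j ⁻¹ᵁ W i).ι (j ∣_ W i) (by simp), ← hf]
    simp

theorem exists_hom_of_forall_range_le [IsReduced Y] [QuasiCompact π] [IsAffineHom ν] [IsAffineHom p]
    (hj : j ≫ ν = π) (hq : q ≫ p = π)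
    (e : ∀ U : X.Opens, π ⁻¹ᵁ U ≤ j ⁻¹ᵁ ν ⁻¹ᵁ U)
    (e' : ∀ U : X.Opens, π ⁻¹ᵁ U ≤ q ⁻¹ᵁ p ⁻¹ᵁ U)
    (hinj : ∀ U : X.Opens, IsAffineOpen U →
      Function.Injective (j.appLE (ν ⁻¹ᵁ U) (π ⁻¹ᵁ U) (e U)).hom)
    (hr : ∀ U : X.Opens, IsAffineOpen U → (q.appLE (p ⁻¹ᵁ U) (π ⁻¹ᵁ U) (e' U)).hom.range ≤
      (j.appLE (ν ⁻¹ᵁ U) (π ⁻¹ᵁ U) (e U)).hom.range) :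
    ∃ h : S ⟶ Z, h ≫ p = ν ∧ j ≫ h = q := by
  obtain ⟨_, _⟩ := isSchemeTheoreticallyDominant_of_injective hj e hinj
  have : IsReduced S := IsSchemeTheoreticallyDominant.isReduced j
  choose f hfp hfq using fun U : X.affineOpens ↦
    exists_hom_of_range_le hj hq U.2 (e U) (e' U) (hinj U U.2) (hr U U.2)
  exact exists_hom_of_isOpenCover (.comap (iSup_affineOpens_eq_top X) ν.base.hom) f hfp hfq

end Descent

/-! ### Gluing morphisms and relative spectra over the affine opens. -/

section Gluing

open Limits Scheme.AffineZariskiSite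

variable {X Y S : Scheme} (π : Y ⟶ X)

/-- The affine opens form a directed cover, so compatibility along inclusions of basic opens
replaces agreement on all overlaps. -/
lemma exists_hom_of_forall_homOfLE_comp_eq
    (f : ∀ U : X.AffineZariskiSite, (π ⁻¹ᵁ U.toOpens).toScheme ⟶ S)
    (hf : ∀ (U V : X.AffineZariskiSite) (h : U ≤ V),
      Y.homOfLE (π.preimage_mono (toOpens_mono h)) ≫ f V = f U) :
    ∃ j : Y ⟶ S, ∀ U : X.AffineZariskiSite, (π ⁻¹ᵁ U.toOpens).ι ≫ j = f U := by
  have key (U V : X.AffineZariskiSite) (h : U ≤ V)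
      (t : pullback π U.toOpens.ι ⟶ pullback π V.toOpens.ι)
      (ht : t ≫ pullback.fst _ _ = pullback.fst _ _) :
      t ≫ (pullbackRestrictIsoRestrict π V.toOpens).hom ≫ f V =
        (pullbackRestrictIsoRestrict π U.toOpens).hom ≫ f U := by
    have : (pullbackRestrictIsoRestrict π U.toOpens).inv ≫ t ≫
        (pullbackRestrictIsoRestrict π V.toOpens).hom = Y.homOfLE
          (π.preimage_mono (toOpens_mono h)) := by
      rw [← cancel_mono (Scheme.Opens.ι _), Scheme.homOfLE_ι, Category.assoc, Category.assoc,
        pullbackRestrictIsoRestrict_hom_ι, Iso.inv_comp_eq, pullbackRestrictIsoRestrict_hom_ι, ht]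
    rw [← Iso.inv_comp_eq, ← hf U V h, ← this]
    simp only [Category.assoc]
  let 𝒰 := (directedCover X).pullback₁ π
  let g : ∀ U : 𝒰.I₀, 𝒰.X U ⟶ S := fun U ↦ (pullbackRestrictIsoRestrict π U.1).hom ≫ f U
  have hg : ∀ {U V : 𝒰.I₀} (i : U ⟶ V), Scheme.Cover.trans 𝒰 i ≫ g V = g U :=
    fun {U V : X.AffineZariskiSite} i ↦ key U V (leOfHom i) _ (Scheme.Cover.trans_map 𝒰 i)
  refine ⟨Scheme.OpenCover.glueMorphismsOfLocallyDirected 𝒰 g hg, fun U ↦ ?_⟩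
  have hj : pullback.fst π U.toOpens.ι ≫ Scheme.OpenCover.glueMorphismsOfLocallyDirected 𝒰 g hg =
      (pullbackRestrictIsoRestrict π U.toOpens).hom ≫ f U :=
    Scheme.OpenCover.map_glueMorphismsOfLocallyDirected 𝒰 _ hg U
  rw [← cancel_epi (pullbackRestrictIsoRestrict π U.toOpens).hom, ← hj,
    pullbackRestrictIsoRestrict_hom_ι_assoc]

theorem exists_glued_of_coequifibered {F : X.AffineZariskiSiteᵒᵖ ⥤ CommRingCat}
    {α : (toOpensFunctor X).op ⋙ X.presheaf ⟶ F} (H : α.Coequifibered) :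
    ∃ (S : Scheme) (ν : S ⟶ X) (c : ∀ U : X.AffineZariskiSite, Spec (F.obj (.op U)) ⟶ S),
      (∀ U, IsOpenImmersion (c U)) ∧
      (∀ U, c U ≫ ν = Spec.map (α.app (.op U)) ≫ U.2.fromSpec) ∧
      (∀ U, ν ⁻¹' U.toOpens = Set.range (c U)) ∧
      ∀ {U V : X.AffineZariskiSite} (i : U ⟶ V), Spec.map (F.map i.op) ≫ c V = c U := by
  let d := relativeGluingData H
  have : (d.functor ⋙ Scheme.forget).IsLocallyDirected :=
    Scheme.Cover.RelativeGluingData.instIsLocallyDirectedI₀CompFunctorForgetOfIsThin ..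
  refine ⟨d.glued, d.toBase, fun U ↦ d.cover.f U, fun U ↦ d.cover.map_prop U,
    fun U ↦ colimit.ι_desc _ _, fun U ↦ ?_, fun i ↦ colimit.w d.functor i⟩
  refine Eq.trans ?_ (d.preimage_toBase_eq_range_ι U)
  exact congrArg (d.toBase ⁻¹' ·) (Scheme.Opens.range_ι U.toOpens).symm

end Gluing

/-! ### The relative spectrum of a family of subrings of sections. -/

lemma isLocalization_away_subring {B B' : Type*} [CommRing B] [CommRing B'] {R : Subring B}
    {R' : Subring B'} (φ : B →+* B') (hφ : ∀ b ∈ R, φ b ∈ R') (g : R)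
    (hg : IsUnit (φ.restrict R R' hφ g))
    (hsurj : ∀ x ∈ R', ∃ n, ∃ y ∈ R, φ y = φ g ^ n * x)
    (hinj : ∀ b, φ b = 0 → ∃ n, (g : B) ^ n * b = 0) :
    letI := (φ.restrict R R' hφ).toAlgebra
    IsLocalization.Away g R' := by
  let _ := (φ.restrict R R' hφ).toAlgebra
  refine IsLocalization.Away.mk g hg (fun x ↦ ?_) fun a b hab ↦ ?_
  · obtain ⟨n, y, hy, h⟩ := hsurj x x.2
    exact ⟨n, ⟨y, hy⟩, Subtype.ext ((mul_comm _ _).trans h.symm)⟩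
  · obtain ⟨n, hn⟩ := hinj (a - b) (by
      rw [map_sub, sub_eq_zero]
      exact congrArg Subtype.val hab)
    exact ⟨n, Subtype.ext (sub_eq_zero.mp (by rw [← hn]; push_cast; ring))⟩

section Sections

open Limits Scheme.AffineZariskiSite Opposite

variable {X Y : Scheme} (π : Y ⟶ X)

/-- Although π⁻¹(U) need not be affine, it is quasi-compact and quasi-separated, which suffices for
sections to localize. -/
lemma isLocalization_away_preimage_basicOpen [QuasiCompact π] [QuasiSeparated π] {U : X.Opens}
    (hU : IsAffineOpen U) (r : Γ(X, U)) :
    letI := (Y.presheaf.map (homOfLE (π.preimage_mono (X.basicOpen_le r))).op).hom.toAlgebra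
    IsLocalization.Away ((π.app U).hom r) Γ(Y, π ⁻¹ᵁ X.basicOpen r) := by
  have key (V : Y.Opens) (hV : V ≤ π ⁻¹ᵁ U) (e : V = Y.basicOpen ((π.app U).hom r)) :
      letI := (Y.presheaf.map (homOfLE hV).op).hom.toAlgebra
      IsLocalization.Away ((π.app U).hom r) Γ(Y, V) := by
    subst e
    exact isLocalization_basicOpen_of_qcqs (π.isCompact_preimage hU.isCompact)
      (π.isQuasiSeparated_preimage hU.isQuasiSeparated) _
  exact key _ _ (π.preimage_basicOpen r)

lemma exists_pow_mul_eq_zero_of_map_eq_zero [QuasiCompact π] [QuasiSeparated π] {U : X.Opens}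
    (hU : IsAffineOpen U) (r : Γ(X, U)) (b : Γ(Y, π ⁻¹ᵁ U))
    (hb : (Y.presheaf.map (homOfLE (π.preimage_mono (X.basicOpen_le r))).op).hom b = 0) :
    ∃ n : ℕ, (π.app U).hom r ^ n * b = 0 := by
  let _ := (Y.presheaf.map (homOfLE (π.preimage_mono (X.basicOpen_le r))).op).hom.toAlgebra
  have := isLocalization_away_preimage_basicOpen π hU r
  obtain ⟨n, hn⟩ := IsLocalization.Away.exists_of_eq (S := Γ(Y, π ⁻¹ᵁ X.basicOpen r))
    ((π.app U).hom r) (a := b) (b := 0) (by rw [map_zero]; exact hb)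
  exact ⟨n, by rw [hn, mul_zero]⟩

variable (R : ∀ U : X.Opens, Subring Γ(Y, π ⁻¹ᵁ U))

/-- The presheaf on affine opens given by a family of subrings stable under restriction. -/
def subringPresheaf
    (hres : ∀ (U : X.Opens), IsAffineOpen U → ∀ (r : Γ(X, U)), ∀ b ∈ R U,
      (Y.presheaf.map (homOfLE (π.preimage_mono (X.basicOpen_le r))).op).hom b ∈
        R (X.basicOpen r)) :
    X.AffineZariskiSiteᵒᵖ ⥤ CommRingCat where
  obj U := .of (R U.unop.toOpens)
  map {V U} i := CommRingCat.ofHom ((Y.presheaf.map (homOfLE (π.preimage_mono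
    (toOpens_mono (leOfHom i.unop)))).op).hom.restrict (R V.unop.toOpens) (R U.unop.toOpens) (by
      obtain ⟨⟨V, hV⟩⟩ := V
      obtain ⟨⟨U, hU⟩⟩ := U
      obtain ⟨r, hr⟩ := leOfHom i.unop
      have hr : X.basicOpen r = U := hr
      subst hr
      exact hres V hV r))
  map_id U := by
    refine CommRingCat.hom_ext (RingHom.ext fun x ↦ Subtype.ext ?_)
    exact congr(($(Y.presheaf.map_id _)).hom x.1)
  map_comp {U V W} i j := by
    refine CommRingCat.hom_ext (RingHom.ext fun x ↦ Subtype.ext ?_)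
    exact congr(($(Y.presheaf.map_comp
      (homOfLE (π.preimage_mono (toOpens_mono (leOfHom i.unop)))).op
      (homOfLE (π.preimage_mono (toOpens_mono (leOfHom j.unop)))).op)).hom x.1)

/-- The structure map from `𝒪_X` to the presheaf given by a family of subrings. -/
def subringPresheafHom (halg : ∀ U a, (π.app U).hom a ∈ R U)
    (hres : ∀ (U : X.Opens), IsAffineOpen U → ∀ (r : Γ(X, U)), ∀ b ∈ R U,
      (Y.presheaf.map (homOfLE (π.preimage_mono (X.basicOpen_le r))).op).hom b ∈
        R (X.basicOpen r)) :
    (toOpensFunctor X).op ⋙ X.presheaf ⟶ subringPresheaf π R hres where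
  app U := CommRingCat.ofHom ((π.app U.unop.toOpens).hom.codRestrict (R U.unop.toOpens) (halg _))
  naturality {U V} i := by
    ext x
    exact Subtype.ext congr(($(π.naturality ((toOpensFunctor X).op.map i))).hom x)

lemma coequifibered_subringPresheafHom [QuasiCompact π] [QuasiSeparated π]
    (halg : ∀ U a, (π.app U).hom a ∈ R U)
    (hres : ∀ (U : X.Opens), IsAffineOpen U → ∀ (r : Γ(X, U)), ∀ b ∈ R U,
      (Y.presheaf.map (homOfLE (π.preimage_mono (X.basicOpen_le r))).op).hom b ∈
        R (X.basicOpen r))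
    (hext : ∀ (U : X.Opens), IsAffineOpen U → ∀ (r : Γ(X, U)), ∀ x ∈ R (X.basicOpen r),
      ∃ n : ℕ, ∃ y ∈ R U,
        (Y.presheaf.map (homOfLE (π.preimage_mono (X.basicOpen_le r))).op).hom y =
          (Y.presheaf.map (homOfLE (π.preimage_mono (X.basicOpen_le r))).op).hom
            ((π.app U).hom r) ^ n * x) :
    (subringPresheafHom π R halg hres).Coequifibered := by
  refine coequifibered_iff_forall_isLocalizationAway.mpr fun U r ↦ ?_
  refine isLocalization_away_subring (R := R U.toOpens) (R' := R (X.basicOpen r))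
    (Y.presheaf.map (homOfLE (π.preimage_mono (X.basicOpen_le r))).op).hom (hres _ U.2 r)
    ⟨(π.app U.toOpens).hom r, halg _ r⟩ ?_ (hext _ U.2 r) fun b hb ↦
      exists_pow_mul_eq_zero_of_map_eq_zero π U.2 r b hb
  have h : IsUnit ((X.presheaf.map (homOfLE (X.basicOpen_le r)).op).hom r) :=
    X.toRingedSpace.isUnit_res_basicOpen r
  convert h.map ((π.app (X.basicOpen r)).hom.codRestrict (R _) (halg _))
  exact Subtype.ext congr(($(π.naturality (homOfLE (X.basicOpen_le r)).op)).hom r).symm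

-- The chart c identifies the sections over its image W with A; on V the morphism j is defined
-- through i, so pullback along j becomes i.
omit π in
lemma exists_iso_hom_comp_eq_appLE {S : Scheme} {A : CommRingCat} {V : Y.Opens} (i : A ⟶ Γ(Y, V))
    (c : Spec A ⟶ S) [IsOpenImmersion c] (j : Y ⟶ S) {W : S.Opens} (hW : W = c.opensRange)
    (e : V ≤ j ⁻¹ᵁ W) (h : V.ι ≫ j = V.toSpecΓ ≫ Spec.map i ≫ c) :
    ∃ ψ : Γ(S, W) ≅ A, ψ.hom ≫ i = j.appLE W V e := by
  have hW' : ⊤ ≤ c ⁻¹ᵁ W := by rw [hW, Scheme.Hom.preimage_opensRange]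
  have : IsIso (c.appLE W ⊤ hW') := by
    have := c.isIso_app W hW.le
    rw [Scheme.Hom.appLE, Subsingleton.elim (homOfLE hW')
      (eqToHom (by rw [hW, Scheme.Hom.preimage_opensRange]))]
    infer_instance
  refine ⟨asIso (c.appLE W ⊤ hW') ≪≫ Scheme.ΓSpecIso A, ?_⟩
  have h₁ : V.ι.appLE V ⊤ (by simp) = V.topIso.inv := by
    rw [Scheme.Opens.ι_appLE]
    rfl
  have e₁ : (⊤ : (Spec Γ(Y, V)).Opens) ≤ Spec.map i ⁻¹ᵁ ⊤ := le_top
  have e₂ : (⊤ : V.toScheme.Opens) ≤ V.toSpecΓ ⁻¹ᵁ ⊤ := le_top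
  have h₂ : (Spec.map i).appLE ⊤ ⊤ e₁ ≫ V.toSpecΓ.appLE ⊤ ⊤ e₂ =
      (Scheme.ΓSpecIso A).hom ≫ i ≫ V.topIso.inv := by
    have h₃ : V.toSpecΓ.appLE ⊤ ⊤ e₂ = V.toSpecΓ.appTop := (Scheme.Hom.app_eq_appLE _).symm
    have h₄ : (Spec.map i).appLE ⊤ ⊤ e₁ = (Spec.map i).appTop := (Scheme.Hom.app_eq_appLE _).symm
    rw [h₃, h₄, Scheme.Opens.toSpecΓ_appTop, Scheme.ΓSpecIso_naturality_assoc]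
  have e₅ : ⊤ ≤ (V.ι ≫ j) ⁻¹ᵁ W := fun x _ ↦ e x.2
  have e₆ : ⊤ ≤ (V.toSpecΓ ≫ Spec.map i ≫ c) ⁻¹ᵁ W := h ▸ e₅
  have h₅ : (V.ι ≫ j).appLE W ⊤ e₅ = (V.toSpecΓ ≫ Spec.map i ≫ c).appLE W ⊤ e₆ := by
    simp_rw [h]
  have h₆ : (V.toSpecΓ ≫ Spec.map i ≫ c).appLE W ⊤ e₆ =
      c.appLE W ⊤ hW' ≫ (Spec.map i).appLE ⊤ ⊤ e₁ ≫ V.toSpecΓ.appLE ⊤ ⊤ e₂ := by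
    rw [Scheme.Hom.appLE_comp_appLE, Scheme.Hom.appLE_comp_appLE]
    simp only [Category.assoc]
  have h₇ := Scheme.Hom.appLE_comp_appLE V.ι j W V ⊤ e (by simp)
  rw [← cancel_mono V.topIso.inv]
  nth_rw 2 [← h₁]
  rw [h₇, h₅, h₆, h₂]
  simp only [Iso.trans_hom, asIso_hom, Category.assoc]

theorem exists_isAffineHom_of_subrings [QuasiCompact π] [QuasiSeparated π]
    (halg : ∀ U a, (π.app U).hom a ∈ R U)
    (hres : ∀ (U : X.Opens), IsAffineOpen U → ∀ (r : Γ(X, U)), ∀ b ∈ R U,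
      (Y.presheaf.map (homOfLE (π.preimage_mono (X.basicOpen_le r))).op).hom b ∈
        R (X.basicOpen r))
    (hext : ∀ (U : X.Opens), IsAffineOpen U → ∀ (r : Γ(X, U)), ∀ x ∈ R (X.basicOpen r),
      ∃ n : ℕ, ∃ y ∈ R U,
        (Y.presheaf.map (homOfLE (π.preimage_mono (X.basicOpen_le r))).op).hom y =
          (Y.presheaf.map (homOfLE (π.preimage_mono (X.basicOpen_le r))).op).hom
            ((π.app U).hom r) ^ n * x) :
    ∃ (S : Scheme) (j : Y ⟶ S) (ν : S ⟶ X) (hj : j ≫ ν = π), IsAffineHom ν ∧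
      ∀ U : X.Opens, IsAffineOpen U →
        Function.Injective (j.appLE (ν ⁻¹ᵁ U) (π ⁻¹ᵁ U) (by rw [← hj]; exact le_rfl)).hom ∧
        (j.appLE (ν ⁻¹ᵁ U) (π ⁻¹ᵁ U) (by rw [← hj]; exact le_rfl)).hom.range = R U := by
  obtain ⟨S, ν, c, hc, hcν, hcr, hcF⟩ := exists_glued_of_coequifibered
    (coequifibered_subringPresheafHom π R halg hres hext)
  let i (U : X.AffineZariskiSite) : CommRingCat.of (R U.toOpens) ⟶ Γ(Y, π ⁻¹ᵁ U.toOpens) :=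
    CommRingCat.ofHom (R U.toOpens).subtype
  let c' (U : X.AffineZariskiSite) : Spec (CommRingCat.of (R U.toOpens)) ⟶ S := c U
  have hc' (U) : IsOpenImmersion (c' U) := hc U
  have hcr' (U : X.AffineZariskiSite) : ν ⁻¹ᵁ U.toOpens = (c' U).opensRange :=
    TopologicalSpace.Opens.ext (hcr U)
  have hcν' (U : X.AffineZariskiSite) : Spec.map (i U) ≫ c' U ≫ ν =
      Spec.map (π.app U.toOpens) ≫ U.2.fromSpec := by
    let a : Γ(X, U.toOpens) ⟶ CommRingCat.of (R U.toOpens) :=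
      (subringPresheafHom π R halg hres).app (op U)
    have ha : a ≫ i U = π.app U.toOpens := rfl
    have h : c' U ≫ ν = Spec.map a ≫ U.2.fromSpec := hcν U
    rw [h, ← ha, Spec.map_comp, Category.assoc]
  obtain ⟨j, hj⟩ := exists_hom_of_forall_homOfLE_comp_eq π
    (fun U ↦ (π ⁻¹ᵁ U.toOpens).toSpecΓ ≫ Spec.map (i U) ≫ c' U) fun U V h ↦ by
      let m : CommRingCat.of (R V.toOpens) ⟶ CommRingCat.of (R U.toOpens) :=
        (subringPresheaf π R hres).map (homOfLE h).op
      have hm : Spec.map m ≫ c' V = c' U := hcF (homOfLE h)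
      have hi : i V ≫ Y.presheaf.map (homOfLE (π.preimage_mono (toOpens_mono h))).op =
        m ≫ i U := rfl
      rw [← Scheme.Opens.toSpecΓ_SpecMap_presheaf_map_assoc, ← Spec.map_comp_assoc, hi, ← hm,
        Spec.map_comp, Category.assoc]
  have hfac : j ≫ ν = π := by
    refine (Y.openCoverOfIsOpenCover _ (.comap (iSup_affineOpens_eq_top X) π.base.hom)).hom_ext
      _ _ fun (U : X.AffineZariskiSite) ↦ ?_
    change (π ⁻¹ᵁ U.toOpens).ι ≫ j ≫ ν = (π ⁻¹ᵁ U.toOpens).ι ≫ π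
    rw [← Category.assoc, hj, Category.assoc, Category.assoc, hcν' U, Scheme.Hom.app_eq_appLE,
      Scheme.Opens.toSpecΓ_SpecMap_appLE_assoc]
    simp
  refine ⟨S, j, ν, hfac, ?_, fun U hU ↦ ?_⟩
  · refine isAffineHom_of_forall_exists_isAffineOpen _ fun x ↦ ?_
    obtain ⟨_, ⟨U, hU, rfl⟩, hxU, -⟩ := X.isBasis_affineOpens.exists_subset_of_mem_open
      (Set.mem_univ x) isOpen_univ
    have := hc' ⟨U, hU⟩
    refine ⟨U, hxU, hU, ?_⟩
    rw [show ν ⁻¹ᵁ U = _ from hcr' ⟨U, hU⟩]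
    exact isAffineOpen_opensRange (c' ⟨U, hU⟩)
  · have := hc' ⟨U, hU⟩
    obtain ⟨ψ, hψ⟩ := exists_iso_hom_comp_eq_appLE (i ⟨U, hU⟩) (c' ⟨U, hU⟩) j (hcr' ⟨U, hU⟩)
      (by rw [← hfac]; exact le_rfl) (hj ⟨U, hU⟩)
    rw [← hψ]
    have hb : Function.Bijective ψ.hom.hom := ConcreteCategory.bijective_of_isIso ψ.hom
    refine ⟨Subtype.val_injective.comp hb.1, SetLike.ext fun b ↦ ⟨?_, fun hb' ↦ ?_⟩⟩
    · rintro ⟨x, rfl⟩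
      exact (ψ.hom.hom x).2
    · obtain ⟨x, hx⟩ := hb.2 ⟨b, hb'⟩
      exact ⟨x, congrArg Subtype.val hx⟩

end Sections

/-! ### Existence of the central seminormalization as a scheme. -/

section Existence

variable {X Y : Scheme} (π : Y ⟶ X)

lemma app_mem_seminormalizationSections_self (U : X.Opens) (a : Γ(X, U)) :
    (π.app U).hom a ∈ seminormalizationSections π U :=
  letI := (π.app U).hom.toAlgebra
  (centralSeminormalization Γ(X, U) Γ(Y, π ⁻¹ᵁ U)).algebraMap_mem a

variable [IsIntegral X] [IsIntegral Y] [IsDominant π] [QuasiCompact π] [QuasiSeparated π]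

theorem seminormalizationSections_basicOpen {U : X.Opens} (hU : IsAffineOpen U) (r : Γ(X, U)) :
    (∀ b ∈ seminormalizationSections π U,
      (Y.presheaf.map (homOfLE (π.preimage_mono (X.basicOpen_le r))).op).hom b ∈
        seminormalizationSections π (X.basicOpen r)) ∧
    ∀ x ∈ seminormalizationSections π (X.basicOpen r),
      ∃ n : ℕ, ∃ y ∈ seminormalizationSections π U,
        (Y.presheaf.map (homOfLE (π.preimage_mono (X.basicOpen_le r))).op).hom y =
          (Y.presheaf.map (homOfLE (π.preimage_mono (X.basicOpen_le r))).op).hom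
            ((π.app U).hom r) ^ n * x := by
  by_cases hne : Nonempty (X.basicOpen r); swap
  · have := subsingleton_sections_preimage π (X.basicOpen r) hne
    exact ⟨fun b _ ↦ mem_seminormalizationSections_of_isEmpty π _ hne _,
      fun x _ ↦ ⟨0, 0, zero_mem _, Subsingleton.elim _ _⟩⟩
  have hne' : Nonempty U := ⟨⟨_, X.basicOpen_le r hne.some.2⟩⟩
  have := nonempty_preimage π U
  have := nonempty_preimage π (X.basicOpen r)
  let _ : Algebra Γ(X, U) Γ(X, X.basicOpen r) :=
    (X.presheaf.map (homOfLE (X.basicOpen_le r)).op).hom.toAlgebra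
  let _ : Algebra Γ(Y, π ⁻¹ᵁ U) Γ(Y, π ⁻¹ᵁ X.basicOpen r) :=
    (Y.presheaf.map (homOfLE (π.preimage_mono (X.basicOpen_le r))).op).hom.toAlgebra
  let _ : Algebra Γ(X, U) Γ(Y, π ⁻¹ᵁ U) := (π.app U).hom.toAlgebra
  let _ : Algebra Γ(X, X.basicOpen r) Γ(Y, π ⁻¹ᵁ X.basicOpen r) :=
    (π.app (X.basicOpen r)).hom.toAlgebra
  let _ : Algebra Γ(X, U) Γ(Y, π ⁻¹ᵁ X.basicOpen r) :=
    ((Y.presheaf.map (homOfLE (π.preimage_mono (X.basicOpen_le r))).op).hom.comp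
      (π.app U).hom).toAlgebra
  have : IsScalarTower Γ(X, U) Γ(Y, π ⁻¹ᵁ U) Γ(Y, π ⁻¹ᵁ X.basicOpen r) := .of_algebraMap_eq' rfl
  have : IsScalarTower Γ(X, U) Γ(X, X.basicOpen r) Γ(Y, π ⁻¹ᵁ X.basicOpen r) :=
    .of_algebraMap_eq' congr(($(π.naturality (homOfLE (X.basicOpen_le r)).op)).hom).symm
  have : FaithfulSMul Γ(X, U) Γ(Y, π ⁻¹ᵁ U) :=
    (faithfulSMul_iff_algebraMap_injective _ _).mpr (app_injective_of_isDominant π U)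
  have : FaithfulSMul Γ(X, X.basicOpen r) Γ(Y, π ⁻¹ᵁ X.basicOpen r) :=
    (faithfulSMul_iff_algebraMap_injective _ _).mpr (app_injective_of_isDominant π _)
  have : IsLocalization.Away r Γ(X, X.basicOpen r) := hU.isLocalization_basicOpen r
  have : IsLocalization.Away (algebraMap Γ(X, U) Γ(Y, π ⁻¹ᵁ U) r) Γ(Y, π ⁻¹ᵁ X.basicOpen r) :=
    isLocalization_away_preimage_basicOpen π hU r
  have hr : r ≠ 0 := by
    rintro rfl
    obtain ⟨x, hx⟩ := hne
    rw [Scheme.basicOpen_zero] at hx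
    exact hx
  exact ⟨fun b hb ↦ algebraMap_mem_centralSeminormalization_of_away r hr hb,
    fun x hx ↦ exists_mem_centralSeminormalization_of_away r hr hx⟩

/-- Existence of the relative spectrum of the central seminormalization. -/
theorem exists_isCentralSeminormalization :
    ∃ (S : Scheme) (j : Y ⟶ S) (ν : S ⟶ X), IsCentralSeminormalization π j ν := by
  obtain ⟨S, j, ν, hj, hν, h⟩ := exists_isAffineHom_of_subrings π (seminormalizationSections π)
    (app_mem_seminormalizationSections_self π)
    (fun U hU r ↦ (seminormalizationSections_basicOpen π hU r).1)
    fun U hU r ↦ (seminormalizationSections_basicOpen π hU r).2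
  exact ⟨S, j, ν, hj, hν, fun U hU ↦ (h U hU).1, fun U hU ↦ (h U hU).2⟩

end Existence

/-! ### Finiteness, integrality and the universal property. -/

section Main

variable {X Y S : Scheme.{0}} [IsIntegral X] [IsIntegral Y]

/-- The central seminormalization of a variety in a dominant variety over it is finite. -/
theorem IsCentralSeminormalization.isFinite (s : X ⟶ Spec (CommRingCat.of ℝ))
    [LocallyOfFiniteType s] {π : Y ⟶ X} [IsDominant π] [LocallyOfFiniteType π] [QuasiCompact π]
    {j : Y ⟶ S} {ν : S ⟶ X} (h : IsCentralSeminormalization π j ν) : IsFinite ν := by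
  have := h.isAffineHom
  refine ⟨fun U hU ↦ ?_⟩
  by_cases hne : Nonempty U; swap
  · have := subsingleton_sections_preimage ν U hne
    exact RingHom.Finite.of_surjective _ fun x ↦ ⟨0, Subsingleton.elim _ _⟩
  obtain ⟨⟨y, hy⟩⟩ := nonempty_preimage π U
  obtain ⟨_, ⟨V, hV, rfl⟩, hyV, hVU⟩ := Y.isBasis_affineOpens.exists_subset_of_mem_open hy
    (π ⁻¹ᵁ U).isOpen
  have : Nonempty (π ⁻¹ᵁ U) := ⟨⟨y, hy⟩⟩
  have : Nonempty V := ⟨⟨y, hyV⟩⟩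
  let k : ℝ →+* Γ(X, U) := ((s.appLE ⊤ U le_top).hom.comp
    (Scheme.ΓSpecIso (CommRingCat.of ℝ)).inv.hom)
  have hk : k.FiniteType := RingHom.FiniteType.comp
    (s.finiteType_appLE (isAffineOpen_top _) hU le_top)
    (.of_surjective _ (ConcreteCategory.bijective_of_isIso
      (Scheme.ΓSpecIso (CommRingCat.of ℝ)).inv).2)
  have hπV : (π.appLE U V hVU).hom.FiniteType := π.finiteType_appLE hU hV hVU
  let _ : Algebra ℝ Γ(X, U) := k.toAlgebra
  let _ : Algebra Γ(X, U) Γ(Y, π ⁻¹ᵁ U) := (π.app U).hom.toAlgebra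
  let _ : Algebra Γ(X, U) Γ(Y, V) := (π.appLE U V hVU).hom.toAlgebra
  let _ : Algebra Γ(X, U) Γ(S, ν ⁻¹ᵁ U) := (ν.app U).hom.toAlgebra
  have : Algebra.FiniteType ℝ Γ(X, U) := hk
  have : Algebra.FiniteType Γ(X, U) Γ(Y, V) := hπV
  let ι : Γ(Y, π ⁻¹ᵁ U) →ₐ[Γ(X, U)] Γ(Y, V) :=
    { (Y.presheaf.map (homOfLE hVU).op).hom with commutes' := fun _ ↦ rfl }
  have hι : Function.Injective ι := map_injective_of_isIntegral Y (homOfLE hVU)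
  have : FaithfulSMul Γ(X, U) Γ(Y, V) := (faithfulSMul_iff_algebraMap_injective _ _).mpr
    (hι.comp (app_injective_of_isDominant π U))
  have hfin : Module.Finite Γ(X, U) (centralSeminormalization Γ(X, U) Γ(Y, π ⁻¹ᵁ U)) :=
    finite_subalgebra_of_le_integralClosure ℝ ι hι _ centralSeminormalization_le_integralClosure
  have : IsNoetherianRing Γ(X, U) := Algebra.FiniteType.isNoetherianRing ℝ _
  have e : π ⁻¹ᵁ U ≤ j ⁻¹ᵁ ν ⁻¹ᵁ U := by rw [← h.fac]; exact le_rfl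
  have hc (a : Γ(X, U)) : (j.appLE (ν ⁻¹ᵁ U) (π ⁻¹ᵁ U) e).hom ((ν.app U).hom a) =
      (π.app U).hom a := by
    have : ν.app U ≫ j.appLE (ν ⁻¹ᵁ U) (π ⁻¹ᵁ U) e = π.app U := by
      simp_rw [Scheme.Hom.app_eq_appLE, Scheme.Hom.appLE_comp_appLE, h.fac]
    exact congr($(this).hom a)
  let φ : Γ(S, ν ⁻¹ᵁ U) →ₐ[Γ(X, U)] Γ(Y, π ⁻¹ᵁ U) :=
    { (j.appLE (ν ⁻¹ᵁ U) (π ⁻¹ᵁ U) e).hom with commutes' := hc }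
  let ψ := φ.codRestrict (centralSeminormalization Γ(X, U) Γ(Y, π ⁻¹ᵁ U)) fun x ↦
    (h.range_eq U hU).le ⟨x, rfl⟩
  have hψ : Function.Injective ψ.toLinearMap := fun x y hxy ↦
    h.injective U hU (congrArg Subtype.val hxy)
  exact Module.Finite.of_injective ψ.toLinearMap hψ

-- S is the closure of the image of the irreducible Y, and it inherits reducedness because j is
-- scheme-theoretically dominant.
omit [IsIntegral X] in
theorem IsCentralSeminormalization.isIntegral {π : Y ⟶ X} [QuasiCompact π] {j : Y ⟶ S} {ν : S ⟶ X}
    (h : IsCentralSeminormalization π j ν) : IsIntegral S := by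
  have := h.isAffineHom
  obtain ⟨_, _⟩ := isSchemeTheoreticallyDominant_of_injective h.fac
    (fun U ↦ by rw [← h.fac]; exact le_rfl) h.injective
  have : IsReduced S := IsSchemeTheoreticallyDominant.isReduced j
  have : IrreducibleSpace S := by
    have := ((IrreducibleSpace.isIrreducible_univ Y).image j j.continuous.continuousOn).closure
    rw [Set.image_univ, j.denseRange.closure_range] at this
    exact (irreducibleSpace_def S).mpr this
  exact isIntegral_of_irreducibleSpace_of_isReduced S

variable {Z : Scheme.{0}}

/-- Both sides say that p is affine with its sections inside those of S, viewed in Y. Given f, it is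
dominant because q is, so finiteness of ν descends to p, and each section of Z reaches Y through S.
-/
theorem IsCentralSeminormalization.isCentrallySubintegral_iff (s : X ⟶ Spec (CommRingCat.of ℝ))
    [LocallyOfFiniteType s] {q : Y ⟶ Z} {p : Z ⟶ X} [IsIntegral Z] [IsSeparated p] [IsDominant q]
    [IsDominant (q ≫ p)] [LocallyOfFiniteType (q ≫ p)] [QuasiCompact (q ≫ p)]
    {j : Y ⟶ S} {ν : S ⟶ X} (h : IsCentralSeminormalization (q ≫ p) j ν) :
    IsCentrallySubintegral p ↔ ∃ f : S ⟶ Z, f ≫ p = ν ∧ j ≫ f = q := by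
  have := h.isAffineHom
  have : QuasiCompact q := .of_comp q p
  have : IsDominant p := .of_comp q p
  have e (U : X.Opens) : (q ≫ p) ⁻¹ᵁ U ≤ j ⁻¹ᵁ ν ⁻¹ᵁ U := by rw [← h.fac]; exact le_rfl
  constructor
  · intro hp
    have := hp.isFinite
    refine exists_hom_of_forall_range_le h.fac rfl e (fun _ ↦ le_rfl) h.injective
      fun U hU ↦ ?_
    rw [h.range_eq U hU]
    rintro _ ⟨c, rfl⟩
    have hc : (q.appLE (p ⁻¹ᵁ U) ((q ≫ p) ⁻¹ᵁ U) le_rfl).hom c = (q.app (p ⁻¹ᵁ U)).hom c :=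
      congr($(Scheme.Hom.app_eq_appLE q).hom c).symm
    exact (congrArg (· ∈ seminormalizationSections (q ≫ p) U) hc).mpr
      (app_mem_seminormalizationSections q p hp hU c)
  · rintro ⟨f, rfl, hf⟩
    have := h.isFinite s
    have : IsDominant (j ≫ f) := hf ▸ inferInstance
    have : IsDominant f := .of_comp j f
    have : IsLocallyNoetherian X := LocallyOfFiniteType.isLocallyNoetherian s
    have : IsFinite p := isFinite_of_isFinite_comp f p
    refine isCentrallySubintegral_of_forall_app_mem q p fun U hU c ↦ ?_
    rw [← h.range_eq U hU]
    refine ⟨(f.app (p ⁻¹ᵁ U)).hom c, ?_⟩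
    have : f.app (p ⁻¹ᵁ U) ≫ j.appLE ((f ≫ p) ⁻¹ᵁ U) ((q ≫ p) ⁻¹ᵁ U) (e U) =
        q.app (p ⁻¹ᵁ U) := by
      rw [Scheme.Hom.app_eq_appLE, Scheme.Hom.app_eq_appLE]
      refine (Scheme.Hom.appLE_comp_appLE j f (p ⁻¹ᵁ U) _ _ _ _).trans ?_
      simp_rw [hf]
      rfl
    exact congr($(this).hom c)

end Main

end CentralGeometry

theorem mainTheorem10 {X Y : Scheme.{0}} [IsIntegral X] [IsIntegral Y]
    (s : X ⟶ Spec (CommRingCat.of ℝ)) [LocallyOfFiniteType s] [QuasiCompact s]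
    (π : Y ⟶ X) [IsDominant π] [LocallyOfFiniteType π] [QuasiCompact π] :
    (∃ (S : Scheme.{0}) (j : Y ⟶ S) (ν : S ⟶ X),
      IsIntegral S ∧ IsFinite ν ∧ CentralGeometry.IsCentralSeminormalization π j ν) ∧
    ∀ (S : Scheme.{0}) (j : Y ⟶ S) (ν : S ⟶ X),
      CentralGeometry.IsCentralSeminormalization π j ν →
      ∀ (Z : Scheme.{0}) (q : Y ⟶ Z) (p : Z ⟶ X),
        IsIntegral Z → IsSeparated p → IsDominant q → q ≫ p = π →
        (CentralGeometry.IsCentrallySubintegral p ↔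
          ∃ h : S ⟶ Z, h ≫ p = ν ∧ j ≫ h = q) := by
  -- This supplies quasi-separatedness of π, needed to localize sections over π⁻¹(U).
  have : IsLocallyNoetherian Y := LocallyOfFiniteType.isLocallyNoetherian (π ≫ s)
  constructor
  · obtain ⟨S, j, ν, h⟩ := CentralGeometry.exists_isCentralSeminormalization π
    exact ⟨S, j, ν, h.isIntegral, h.isFinite s, h⟩
  · rintro S j ν h Z q p _ _ _ rfl
    exact h.isCentrallySubintegral_iff s
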